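/- **Theorem 3.4 (non-reversible generalized second Ray–Knight isomorphism).** Let $P$ be the transition matrix of an irreducible Markov chain on a finite state space $V$, let $\pi$ be its stationary distribution, $\Pi=\mathrm{diag}(\pi)$, and let $Q=\Pi(P-I)$ be its Laplacian. Fix $a\in V$ and $h>0$. Let $\ell$ be a $1$-permanental random vector with kernel $G^h=(h\,e_ae_a^T-Q)^{-1}$, i.e. a random vector with values in $\mathbb{R}_+^V$ such that $$\mathbb{E}\big[e^{-\langle\lambda,\ell\rangle}\big]=\det\big(I+\mathrm{diag}(\lambda)\,G^h\big)^{-1}\qquad\text{for all }\lambda\in\mathbb{R}_+^V .$$ Let $X=(X_s)_{s\ge 0}$ be a right-continuous continuous-time Markov chain on $V$ with rate matrix $Q$ and $X_0=a$, independent of $\ell$, and write $$\mathcal{L}_t^i=\int_0^t\mathbf{1}\{X_s=i\}\,ds\quad(i\in V),\qquad \tau_{\mathrm{inv}}(r)=\inf\{s\ge 0:\mathcal{L}_s^a\ge r\}.$$ For a random vector $W$, a conditional expectation $\mathbb{E}[u(W)\,|\,\ell_a=y]$ at a single value $y\ge 0$ is taken with respect to the version of the regular conditional law of $W$ given $\ell_a=y$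 that is weakly continuous in $y\in[0,\infty)$. Then, for every $r\ge 0$, such continuous versions exist for $W=\ell$ and for $W=\ell+\mathcal{L}_{\tau_{\mathrm{inv}}(r)}$, and for every smooth compactly supported $u:\mathbb{R}_+^V\to\mathbb{C}$ and every such pair of versions, $$\mathbb{E}_a\big[u\big(\ell+\mathcal{L}_{\tau_{\mathrm{inv}}(r)}\big)\,\big|\,\ell_a=0\big]=\mathbb{E}\big[u(\ell)\,\big|\,\ell_a=r\big],$$ where $\mathbb{E}_a$ denotes expectation over both $X$ (started at $a$) and $\ell$. -/

import Mathlib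

open MeasureTheory ProbabilityTheory Filter Topology
open scoped NNReal BoundedContinuousFunction

noncomputable section

namespace RayKnight

/-- `P` is the transition matrix of an irreducible discrete-time Markov chain on the finite state
space `ι`, and `π` is its stationary distribution. -/
structure IsIrreducibleChain {ι : Type*} [Fintype ι] [DecidableEq ι]
    (P : Matrix ι ι ℝ) (π : ι → ℝ) : Prop where
  stochastic : P ∈ Matrix.rowStochastic ℝ ι
  irreducible : P.IsIrreducible
  nonneg : ∀ i, 0 ≤ π i
  sum_eq_one : ∑ i, π i = 1
  stationary : Matrix.vecMul π P = π

/-- The (normalized) Laplacian `Q = Π (P - I)`, with `Π = diag π`. -/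
def laplacian {ι : Type*} [Fintype ι] [DecidableEq ι]
    (P : Matrix ι ι ℝ) (π : ι → ℝ) : Matrix ι ι ℝ :=
  Matrix.diagonal π * (P - 1)

/-- The random vector `ℓ`, with values in the nonnegative orthant, is `α`-permanental with kernel
`G`: its Laplace transform is `E[exp(-⟨x, ℓ⟩)] = det(I + diag(x) G) ^ (-α)` for all `x ≥ 0`. -/
structure IsPermanental {Ω ι : Type*} [MeasurableSpace Ω] [Fintype ι] [DecidableEq ι]
    (μ : Measure Ω) (α : ℝ) (G : Matrix ι ι ℝ) (ℓ : Ω → ι → ℝ) : Prop where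
  measurable : Measurable ℓ
  nonneg : ∀ ω i, 0 ≤ ℓ ω i
  laplace : ∀ x : ι → ℝ, (∀ i, 0 ≤ x i) →
    ∫ ω, Real.exp (-∑ i, x i * ℓ ω i) ∂μ = (1 + Matrix.diagonal x * G).det ^ (-α)

/-- `X` is, under `μ`, a continuous-time Markov chain on the finite state space `ι` with rate
matrix `Q`, started at `a`: its paths are right-continuous (for the discrete topology on `ι`), and
its finite-dimensional distributions are those given by the transition semigroup `exp (t Q)` and
the initial state `a`. -/
structure IsMarkovChain {Ω ι : Type*} [MeasurableSpace Ω] [Fintype ι] [DecidableEq ι]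
    [MeasurableSpace ι] (μ : Measure Ω) (Q : Matrix ι ι ℝ) (a : ι) (X : ℝ≥0 → Ω → ι) : Prop where
  measurable : ∀ t, Measurable (X t)
  rightContinuous : ∀ ω t, ∀ᶠ s in 𝓝[≥] t, X s ω = X t ω
  finiteDimensional : ∀ (k : ℕ) (t : Fin (k + 1) → ℝ≥0), Monotone t → ∀ i : Fin (k + 1) → ι,
    μ.real {ω | ∀ j, X (t j) ω = i j} =
      NormedSpace.exp ((t 0 : ℝ) • Q) a (i 0) *
        ∏ j : Fin k, NormedSpace.exp (((t j.succ : ℝ) - (t j.castSucc : ℝ)) • Q)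
          (i j.castSucc) (i j.succ)

/-- The local time `𝓛_t^i = ∫_0^t 1{X_s = i} ds` of a path `x`, as a vector indexed by `i`. -/
def localTime {ι : Type*} [DecidableEq ι] (x : ℝ≥0 → ι) (t : ℝ≥0) : ι → ℝ :=
  fun i => ∫ s in (0 : ℝ)..t, if x s.toNNReal = i then 1 else 0

/-- The inverse local time at `a`: `τ_inv(r) = inf {s ≥ 0 : 𝓛_s^a ≥ r}`. -/
def invLocalTime {ι : Type*} [DecidableEq ι] (x : ℝ≥0 → ι) (a : ι) (r : ℝ) : ℝ≥0 :=
  sInf {s : ℝ≥0 | r ≤ localTime x s a}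

/-- `κ y` is the conditional law of the random vector `W` given `Y = y`, where `Y ≥ 0` is a real
random variable, in the version which is (weakly) continuous in `y` on `[0, ∞)`. When the law of
`Y` has full support in `[0, ∞)`, this continuity determines `κ y` for every single `y ≥ 0`, and
then `E[u(W) | Y = y] = ∫ w, u w ∂κ y`. -/
structure IsContCondLaw {Ω ι : Type*} [MeasurableSpace Ω] [Fintype ι]
    (μ : Measure Ω) (W : Ω → ι → ℝ) (Y : Ω → ℝ) (κ : Kernel ℝ (ι → ℝ)) : Prop where
  markov : IsMarkovKernel κ
  hasCondDistrib : HasCondDistrib W Y κ μ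
  continuousOn : ∀ f : (ι → ℝ) →ᵇ ℝ, ContinuousOn (fun y => ∫ w, f w ∂(κ y)) (Set.Ici 0)

/-- `u : ℝ_+^ι → ℂ` is smooth (up to the boundary of the orthant) and compactly supported in the
closed orthant; the values of `u` outside the orthant play no role. -/
def IsTestFunction {ι : Type*} [Fintype ι] (u : (ι → ℝ) → ℂ) : Prop :=
  ContDiffOn ℝ (⊤ : ℕ∞) u (Set.Ici 0) ∧
    ∃ K : Set (ι → ℝ), IsCompact K ∧ ∀ l ∈ Set.Ici (0 : ι → ℝ), l ∉ K → u l = 0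

end RayKnight

end

/-!
Everything is read off from Laplace transforms. For `lam ≥ 0` let `N` be the determinant of
`diag lam - Q` (`killedDet`), `D` its principal minor without the state `a` (`killedMinor`),
`ψ = N / D` (`lapExponent`) and `c = D(0) / D` (`minorRatio`). Raising `lam a` by `θ` turns `ψ` into
`ψ + θ` and leaves `c` alone, and `ψ(0) = 0` since `Q` annihilates constants. Three facts follow.

* The permanental vector has transform `E exp(-⟨lam, ℓ⟩) = c * h / (h + ψ)`
  (`IsIrreducibleChain.laplace_permanental`). Shifting `lam a` shows that `ℓ a` is exponential with
  parameter `h`, and that a law with transform `c * exp(-y ψ)` is the conditional law of `ℓ` given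
  `ℓ a = y`.
* The local times at the inverse local time `r` have transform `exp(-r ψ)`
  (`integral_exp_neg_localTime_invLocalTime`). Neither excursion theory nor the strong Markov
  property is needed. Substituting `r = L_s^a` along each path
  (`integral_indicator_expLocalTimeInv`) expresses the Laplace transform in `r` of that quantity, at
  `θ`, by the potential at `a` of the chain killed at rate `lam + θ 1_a`. By the Feynman–Kac formula
  for the resolvent (`vecMul_integral_feynmanKac`) this potential is the diagonal entry
  `(diag (lam + θ 1_a) - Q)⁻¹ a a = 1 / (ψ + θ)`. Inverting the Laplace transform gives the claim
  for almost every `r`, and monotonicity in `r` gives it for all `r`.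
* There is a law with transform `c`: the limit of the laws of `ℓ` under the weights `exp(-n ℓ_a)`
  (`exists_law_vanishing`). Its convolution with the law of the local times at the inverse local
  time `y` has transform `c * exp(-y ψ)`. These laws form a Markov kernel `κ`
  (`exists_isLaplaceKernel`), weakly continuous in `y ≥ 0` because the transforms are
  (`IsLaplaceKernel.continuousOn`).

So `κ y` is the continuous conditional law of `ℓ` given `ℓ a = y`. By independence, `κ (y + r)` is
that of `ℓ` plus the local times at the inverse local time `r` (`IsLaplaceKernel.isContCondLaw`).
At `y = 0` the latter is `κ r`, which is the isomorphism. The choice of versions does not matter: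
the law of `ℓ a` charges every open subset of `(0, ∞)`, so continuous versions agree on `[0, ∞)`
(`IsContCondLaw.eq`).
-/

noncomputable section

namespace RayKnight

/-! ### Determinants of Laplacians with killing -/

section Determinants

variable {ι : Type*} [Fintype ι] [DecidableEq ι]

/-- `t ↦ det (M + t)` is a monic polynomial without zeros on `[0, ∞)`, hence positive there. -/
theorem det_pos_of_forall_det_add_smul_ne_zero (M : Matrix ι ι ℝ)
    (hM : ∀ t : ℝ, 0 ≤ t → (M + t • (1 : Matrix ι ι ℝ)).det ≠ 0) : 0 < M.det := by
  have hev : ∀ t : ℝ, (-M).charpoly.eval t = (M + t • (1 : Matrix ι ι ℝ)).det := by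
    intro t
    rw [Matrix.eval_charpoly]
    congr 1
    rw [sub_neg_eq_add, add_comm, Matrix.smul_one_eq_diagonal]
    rfl
  have h0 : M.det = (-M).charpoly.eval 0 := by simp [hev]
  rcases isEmpty_or_nonempty ι with hι | hι
  · simp
  by_contra hneg
  push Not at hneg
  have htop : Tendsto (fun t => (-M).charpoly.eval t) atTop atTop := by
    apply Polynomial.tendsto_atTop_of_leadingCoeff_nonneg
    · rw [Matrix.charpoly_degree_eq_dim]
      exact_mod_cast Fintype.card_pos
    · rw [(Matrix.charpoly_monic _).leadingCoeff]; exact zero_le_one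
  obtain ⟨T, hT1, hT0⟩ := ((htop.eventually_ge_atTop 1).and (eventually_ge_atTop 0)).exists
  have hmem : (0 : ℝ) ∈ Set.Icc ((-M).charpoly.eval 0) ((-M).charpoly.eval T) :=
    ⟨by rw [← h0]; exact hneg, by linarith⟩
  obtain ⟨t, ht, hte⟩ := intermediate_value_Icc hT0
    ((-M).charpoly.continuous.continuousOn) hmem
  exact hM t ht.1 (by rw [← hev]; exact hte)

/-- Injectivity from a one-sided maximum principle, applied to both signs of a kernel vector. -/
theorem det_ne_zero_of_forall_mulVec (M : Matrix ι ι ℝ)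
    (hM : ∀ v : ι → ℝ, M.mulVec v = 0 → ∀ i, v i ≤ 0) : M.det ≠ 0 := by
  intro h
  obtain ⟨v, hv, hv0⟩ := Matrix.exists_mulVec_eq_zero_iff.2 h
  apply hv
  funext i
  have h1 := hM v hv0 i
  have h2 := hM (-v) (by rw [Matrix.mulVec_neg, hv0, neg_zero]) i
  simp only [Pi.neg_apply, Pi.zero_apply] at h2 ⊢
  linarith

end Determinants

section Laplacian

variable {ι : Type*} [Fintype ι] [DecidableEq ι] {P : Matrix ι ι ℝ} {π : ι → ℝ}

/-- The stationary distribution charges every state: mass flows along powers of `P` from any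
charged state to any other. -/
theorem IsIrreducibleChain.pos (hP : IsIrreducibleChain P π) (i : ι) : 0 < π i := by
  obtain ⟨j, hj⟩ : ∃ j, 0 < π j := by
    by_contra hcon
    push Not at hcon
    have := Finset.sum_nonpos (s := Finset.univ) (fun j _ => hcon j)
    rw [hP.sum_eq_one] at this
    linarith
  obtain ⟨k, -, hk⟩ := (Matrix.isIrreducible_iff_exists_pow_pos hP.irreducible.nonneg).1
    hP.irreducible j i
  have hst : ∀ n : ℕ, Matrix.vecMul π (P ^ n) = π := by
    intro n
    induction n with
    | zero => simp
    | succ n ih => rw [pow_succ, ← Matrix.vecMul_vecMul, ih, hP.stationary]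
  have hnn : ∀ (n : ℕ) i j, 0 ≤ (P ^ n) i j := fun n =>
    (Matrix.mem_rowStochastic.1 (pow_mem hP.stochastic n)).1
  rw [← hst k]
  refine lt_of_lt_of_le (mul_pos hj hk) ?_
  exact Finset.single_le_sum (f := fun m => π m * (P ^ k) m i)
    (fun m _ => mul_nonneg (hP.nonneg m) (hnn k m i)) (Finset.mem_univ j)

theorem laplacian_mulVec (P : Matrix ι ι ℝ) (π v : ι → ℝ) (i : ι) :
    (laplacian P π).mulVec v i = π i * (P.mulVec v i - v i) := by
  rw [laplacian, ← Matrix.mulVec_mulVec, Matrix.mulVec_diagonal, Matrix.sub_mulVec,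
    Matrix.one_mulVec, Pi.sub_apply]

theorem IsIrreducibleChain.mulVec_sub (hP : IsIrreducibleChain P π) (v : ι → ℝ) (i : ι) :
    P.mulVec v i - v i = ∑ j, P i j * (v j - v i) := by
  have h1 : ∑ j, P i j = 1 := by
    have := congrFun (Matrix.mem_rowStochastic.1 hP.stochastic).2 i
    simpa [Matrix.mulVec, dotProduct] using this
  simp only [mul_sub, Finset.sum_sub_distrib, ← Finset.sum_mul, h1, one_mul]
  rfl

theorem IsIrreducibleChain.laplacian_mulVec_nonpos (hP : IsIrreducibleChain P π) (v : ι → ℝ)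
    (i : ι) (hi : ∀ j, v j ≤ v i) : (laplacian P π).mulVec v i ≤ 0 := by
  rw [laplacian_mulVec, hP.mulVec_sub]
  refine mul_nonpos_of_nonneg_of_nonpos (hP.nonneg i) (Finset.sum_nonpos fun j _ => ?_)
  exact mul_nonpos_of_nonneg_of_nonpos (hP.irreducible.nonneg i j) (by linarith [hi j])

/-- Maximum principle: a function which is subharmonic off `a` wherever it is positive, and which
is nonpositive at `a`, is nonpositive. -/
theorem IsIrreducibleChain.nonpos_of_subharmonic (hP : IsIrreducibleChain P π) (a : ι)
    (v : ι → ℝ) (hva : v a ≤ 0)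
    (hv : ∀ i, i ≠ a → 0 < v i → 0 ≤ (laplacian P π).mulVec v i) (i : ι) : v i ≤ 0 := by
  have : Nonempty ι := ⟨a⟩
  obtain ⟨m, hm⟩ := Finite.exists_max v
  refine (hm i).trans ?_
  by_contra hpos
  push Not at hpos
  -- the maximum propagates along the edges of the chain, and irreducibility carries it to `a`
  have hstep : ∀ j, v j = v m → ∀ k, 0 < P j k → v k = v m := by
    intro j hj k hk
    have hja : j ≠ a := by rintro rfl; linarith
    have h1 := hv j hja (by linarith)
    rw [laplacian_mulVec, hP.mulVec_sub] at h1
    have h2 : 0 ≤ ∑ k, P j k * (v k - v j) := nonneg_of_mul_nonneg_right h1 (hP.pos j)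
    have hterm : ∀ k ∈ Finset.univ, P j k * (v k - v j) ≤ 0 := fun k _ =>
      mul_nonpos_of_nonneg_of_nonpos (hP.irreducible.nonneg j k) (by linarith [hm k])
    have h3 := (Finset.sum_eq_zero_iff_of_nonpos hterm).1
      (le_antisymm (Finset.sum_nonpos hterm) h2) k (Finset.mem_univ k)
    rcases mul_eq_zero.1 h3 with h4 | h4 <;> linarith
  have hpow : ∀ (n : ℕ) k, 0 < (P ^ n) m k → v k = v m := by
    intro n
    induction n with
    | zero =>
      intro k hk
      by_cases hmk : m = k
      · rw [hmk]
      · simp [hmk] at hk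
    | succ n ih =>
      intro k hk
      rw [pow_succ, Matrix.mul_apply] at hk
      obtain ⟨j, -, hj⟩ := Finset.exists_lt_of_sum_lt (s := Finset.univ) (f := fun _ => (0 : ℝ))
        (g := fun j => (P ^ n) m j * P j k) (by simpa using hk)
      have hnn : 0 ≤ (P ^ n) m j :=
        (Matrix.mem_rowStochastic.1 (pow_mem hP.stochastic n)).1 m j
      have hP0 := hP.irreducible.nonneg j k
      exact hstep j (ih j (pos_of_mul_pos_left hj hP0)) k (pos_of_mul_pos_right hj hnn)
  obtain ⟨n, -, hn⟩ := (Matrix.isIrreducible_iff_exists_pow_pos hP.irreducible.nonneg).1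
    hP.irreducible m a
  have := hpow n a hn
  linarith

/-- The determinant of `diag lam - Q`, the generator (up to sign) of the chain killed at rate `lam`.
-/
def killedDet (Q : Matrix ι ι ℝ) (lam : ι → ℝ) : ℝ := (Matrix.diagonal lam - Q).det

/-- The principal minor of `diag lam - Q` obtained by deleting the state `a`, written as a diagonal
entry of the adjugate matrix. -/
def killedMinor (Q : Matrix ι ι ℝ) (a : ι) (lam : ι → ℝ) : ℝ :=
  (Matrix.diagonal lam - Q).adjugate a a

theorem killedMinor_eq_det (Q : Matrix ι ι ℝ) (a : ι) (lam : ι → ℝ) :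
    killedMinor Q a lam = ((Matrix.diagonal lam - Q).updateRow a (Pi.single a 1)).det :=
  Matrix.adjugate_apply _ _ _

omit [Fintype ι] in
theorem diagonal_add_single_sub_eq_updateRow (Q : Matrix ι ι ℝ) (a : ι) (lam : ι → ℝ) (θ : ℝ) :
    Matrix.diagonal (lam + Pi.single a θ) - Q =
      (Matrix.diagonal lam - Q).updateRow a
        ((Matrix.diagonal lam - Q) a + θ • Pi.single a 1) := by
  ext i j
  by_cases hi : i = a
  · subst hi
    by_cases hj : j = i
    · subst hj; simp; ring
    · simp [hj, Ne.symm hj]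
  · simp [Matrix.diagonal_apply, hi]

/-- The determinant is affine in the killing rate at `a`. -/
theorem killedDet_add_single (Q : Matrix ι ι ℝ) (a : ι) (lam : ι → ℝ) (θ : ℝ) :
    killedDet Q (lam + Pi.single a θ) = killedDet Q lam + θ * killedMinor Q a lam := by
  rw [killedDet, diagonal_add_single_sub_eq_updateRow, Matrix.det_updateRow_add,
    Matrix.det_updateRow_smul, Matrix.updateRow_eq_self, killedMinor_eq_det, killedDet]

theorem killedMinor_add_single (Q : Matrix ι ι ℝ) (a : ι) (lam : ι → ℝ) (θ : ℝ) :
    killedMinor Q a (lam + Pi.single a θ) = killedMinor Q a lam := by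
  rw [killedMinor_eq_det, diagonal_add_single_sub_eq_updateRow, Matrix.updateRow_idem,
    killedMinor_eq_det]

theorem continuous_killedDet (Q : Matrix ι ι ℝ) : Continuous (killedDet Q) := by
  unfold killedDet; fun_prop

theorem continuous_killedMinor (Q : Matrix ι ι ℝ) (a : ι) : Continuous (killedMinor Q a) := by
  unfold killedMinor
  exact (Continuous.matrix_adjugate (by fun_prop)).matrix_elem a a

/-- Killing at `a` alone already makes the chain transient, so no positivity of `lam` is needed. -/
theorem IsIrreducibleChain.killedMinor_pos (hP : IsIrreducibleChain P π) (a : ι) {lam : ι → ℝ}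
    (hlam : ∀ i, 0 ≤ lam i) : 0 < killedMinor (laplacian P π) a lam := by
  rw [killedMinor_eq_det]
  refine det_pos_of_forall_det_add_smul_ne_zero _ fun t ht =>
    det_ne_zero_of_forall_mulVec _ fun v hv => ?_
  refine hP.nonpos_of_subharmonic a v ?_ ?_
  · have h1 := congrFun hv a
    have h2 : ((Matrix.diagonal lam - laplacian P π).updateRow a (Pi.single a 1)).mulVec v a =
        v a := by
      simp only [Matrix.mulVec, Matrix.updateRow_self, single_dotProduct, one_mul]
    simp only [Matrix.add_mulVec, Matrix.smul_mulVec, Matrix.one_mulVec, Pi.add_apply,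
      Pi.smul_apply, Pi.zero_apply, smul_eq_mul, h2] at h1
    nlinarith
  · intro i hia hvi
    have h1 := congrFun hv i
    have h2 : ((Matrix.diagonal lam - laplacian P π).updateRow a (Pi.single a 1)).mulVec v i =
        (Matrix.diagonal lam - laplacian P π).mulVec v i := by
      simp only [Matrix.mulVec, Matrix.updateRow_ne hia]
    simp only [Matrix.add_mulVec, Matrix.smul_mulVec, Matrix.one_mulVec, Pi.add_apply,
      Pi.smul_apply, Pi.zero_apply, smul_eq_mul, h2, Matrix.sub_mulVec, Pi.sub_apply,
      Matrix.mulVec_diagonal] at h1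
    nlinarith [mul_nonneg (hlam i) hvi.le, mul_nonneg ht hvi.le]

theorem IsIrreducibleChain.killedDet_pos (hP : IsIrreducibleChain P π) {lam : ι → ℝ}
    (hlam : ∀ i, 0 < lam i) : 0 < killedDet (laplacian P π) lam := by
  refine det_pos_of_forall_det_add_smul_ne_zero _ fun t ht =>
    det_ne_zero_of_forall_mulVec _ fun v hv i => ?_
  have : Nonempty ι := ⟨i⟩
  obtain ⟨m, hm⟩ := Finite.exists_max v
  refine (hm i).trans ?_
  by_contra hpos
  push Not at hpos
  have h1 := congrFun hv m
  simp only [Matrix.add_mulVec, Matrix.smul_mulVec, Matrix.one_mulVec, Pi.add_apply,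
      Pi.smul_apply, Pi.zero_apply, smul_eq_mul, Matrix.sub_mulVec, Pi.sub_apply,
      Matrix.mulVec_diagonal] at h1
  nlinarith [mul_pos (hlam m) hpos, mul_nonneg ht hpos.le, hP.laplacian_mulVec_nonpos v m hm]

theorem IsIrreducibleChain.killedDet_nonneg (hP : IsIrreducibleChain P π) {lam : ι → ℝ}
    (hlam : ∀ i, 0 ≤ lam i) : 0 ≤ killedDet (laplacian P π) lam := by
  have h1 : Tendsto (fun t : ℝ => killedDet (laplacian P π) (lam + fun _ => t)) (𝓝[>] 0)
      (𝓝 (killedDet (laplacian P π) lam)) := by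
    have : Continuous (fun t : ℝ => killedDet (laplacian P π) (lam + fun _ => t)) :=
      (continuous_killedDet _).comp (by fun_prop)
    have h2 := this.tendsto 0
    have h3 : (lam + fun _ => (0 : ℝ)) = lam := by ext; simp
    rw [h3] at h2
    exact h2.mono_left nhdsWithin_le_nhds
  refine ge_of_tendsto h1 ?_
  filter_upwards [self_mem_nhdsWithin] with t ht
  exact (hP.killedDet_pos fun i => add_pos_of_nonneg_of_pos (hlam i) ht).le

/-- Constants are in the kernel of the Laplacian. -/
theorem IsIrreducibleChain.killedDet_zero (hP : IsIrreducibleChain P π) [Nonempty ι] :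
    killedDet (laplacian P π) 0 = 0 := by
  rw [killedDet]
  refine Matrix.exists_mulVec_eq_zero_iff.1 ⟨1, one_ne_zero, ?_⟩
  funext i
  rw [show Matrix.diagonal (0 : ι → ℝ) = 0 from Matrix.diagonal_zero, Matrix.sub_mulVec,
    Pi.sub_apply, laplacian_mulVec, (Matrix.mem_rowStochastic.1 hP.stochastic).2]
  simp

/-- The Laplace exponent of the local time field of the chain at the inverse local time at `a`,
see `integral_exp_neg_localTime_invLocalTime`. -/
def lapExponent (Q : Matrix ι ι ℝ) (a : ι) (lam : ι → ℝ) : ℝ :=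
  killedDet Q lam / killedMinor Q a lam

/-- The Laplace transform of a `1`-permanental field conditioned to vanish at `a`. -/
def minorRatio (Q : Matrix ι ι ℝ) (a : ι) (lam : ι → ℝ) : ℝ :=
  killedMinor Q a 0 / killedMinor Q a lam

theorem IsIrreducibleChain.lapExponent_nonneg (hP : IsIrreducibleChain P π) (a : ι) {lam : ι → ℝ}
    (hlam : ∀ i, 0 ≤ lam i) : 0 ≤ lapExponent (laplacian P π) a lam :=
  div_nonneg (hP.killedDet_nonneg hlam) (hP.killedMinor_pos a hlam).le

theorem IsIrreducibleChain.minorRatio_pos (hP : IsIrreducibleChain P π) (a : ι) {lam : ι → ℝ}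
    (hlam : ∀ i, 0 ≤ lam i) : 0 < minorRatio (laplacian P π) a lam :=
  div_pos (hP.killedMinor_pos a fun _ => le_rfl) (hP.killedMinor_pos a hlam)

theorem IsIrreducibleChain.lapExponent_zero (hP : IsIrreducibleChain P π) (a : ι) :
    lapExponent (laplacian P π) a 0 = 0 := by
  have : Nonempty ι := ⟨a⟩
  rw [lapExponent, hP.killedDet_zero, zero_div]

theorem IsIrreducibleChain.minorRatio_zero (hP : IsIrreducibleChain P π) (a : ι) :
    minorRatio (laplacian P π) a 0 = 1 :=
  div_self (hP.killedMinor_pos a fun _ => le_rfl).ne'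

theorem IsIrreducibleChain.lapExponent_add_single (hP : IsIrreducibleChain P π) (a : ι)
    {lam : ι → ℝ} (hlam : ∀ i, 0 ≤ lam i) (θ : ℝ) :
    lapExponent (laplacian P π) a (lam + Pi.single a θ) =
      lapExponent (laplacian P π) a lam + θ := by
  have := (hP.killedMinor_pos a hlam).ne'
  rw [lapExponent, killedDet_add_single, killedMinor_add_single, lapExponent]
  field_simp

theorem minorRatio_add_single (Q : Matrix ι ι ℝ) (a : ι) (lam : ι → ℝ) (θ : ℝ) :
    minorRatio Q a (lam + Pi.single a θ) = minorRatio Q a lam := by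
  rw [minorRatio, killedMinor_add_single, minorRatio]

theorem IsIrreducibleChain.continuousAt_lapExponent (hP : IsIrreducibleChain P π) (a : ι)
    {lam : ι → ℝ} (hlam : ∀ i, 0 ≤ lam i) :
    ContinuousAt (lapExponent (laplacian P π) a) lam :=
  (continuous_killedDet _).continuousAt.div (continuous_killedMinor _ a).continuousAt
    (hP.killedMinor_pos a hlam).ne'

theorem IsIrreducibleChain.continuousAt_minorRatio (hP : IsIrreducibleChain P π) (a : ι)
    {lam : ι → ℝ} (hlam : ∀ i, 0 ≤ lam i) :
    ContinuousAt (minorRatio (laplacian P π) a) lam :=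
  continuousAt_const.div (continuous_killedMinor _ a).continuousAt
    (hP.killedMinor_pos a hlam).ne'

/-- The `(a, a)` entry of the resolvent `(diag lam - Q)⁻¹` is `1 / lapExponent`. The row `a` of the
resolvent is given as the solution `w` of a linear system. -/
theorem IsIrreducibleChain.apply_eq_inv_lapExponent (hP : IsIrreducibleChain P π) (a : ι)
    {lam : ι → ℝ} (hlam : ∀ i, 0 < lam i) (w : ι → ℝ)
    (hw : Matrix.vecMul w (Matrix.diagonal lam - laplacian P π) = Pi.single a 1) :
    w a = (lapExponent (laplacian P π) a lam)⁻¹ := by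
  have h1 := congrArg (fun v => Matrix.vecMul v (Matrix.diagonal lam - laplacian P π).adjugate) hw
  simp only [Matrix.vecMul_vecMul, Matrix.mul_adjugate, Matrix.vecMul_smul, Matrix.vecMul_one] at h1
  have h2 := congrFun h1 a
  rw [Matrix.single_one_vecMul] at h2
  change killedDet (laplacian P π) lam * w a = killedMinor (laplacian P π) a lam at h2
  have := (hP.killedDet_pos hlam).ne'
  rw [lapExponent, inv_div, ← h2]
  field_simp

/-- The Laplace transform of a `1`-permanental vector factors into the part which vanishes at `a`
and an exponential variable with parameter `h`. With `M = h e_a e_aᵀ - Q`, the determinant is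
`det (diag lam + M) / det M`, and both determinants are affine in `h`. -/
theorem IsIrreducibleChain.laplace_permanental (hP : IsIrreducibleChain P π) (a : ι) {h : ℝ}
    (hh : 0 < h) {lam : ι → ℝ} (hlam : ∀ i, 0 ≤ lam i) :
    (1 + Matrix.diagonal lam * (Matrix.single a a h - laplacian P π)⁻¹).det ^ (-(1 : ℝ)) =
      minorRatio (laplacian P π) a lam * (h / (h + lapExponent (laplacian P π) a lam)) := by
  set Q := laplacian P π with hQ
  have hM : Matrix.single a a h - Q = Matrix.diagonal (0 + Pi.single a h) - Q := by
    rw [zero_add, Matrix.diagonal_single]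
  have hM' : Matrix.diagonal lam + (Matrix.single a a h - Q) =
      Matrix.diagonal (lam + Pi.single a h) - Q := by
    have h1 : Matrix.diagonal (lam + Pi.single a h) =
        Matrix.diagonal lam + Matrix.single a a h := by
      rw [← Matrix.diagonal_single, Matrix.diagonal_add]
      rfl
    rw [h1]
    abel
  have : Nonempty ι := ⟨a⟩
  have hD0 := hP.killedMinor_pos a (lam := 0) (fun _ => le_rfl)
  have hD := hP.killedMinor_pos a hlam
  have hN := hP.killedDet_nonneg hlam
  have hdet : (Matrix.single a a h - Q).det = h * killedMinor Q a 0 := by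
    rw [hM]
    change killedDet Q (0 + Pi.single a h) = _
    rw [killedDet_add_single, hP.killedDet_zero, zero_add]
  have hdet' : (Matrix.diagonal lam + (Matrix.single a a h - Q)).det =
      killedDet Q lam + h * killedMinor Q a lam := by
    rw [hM']; exact killedDet_add_single Q a lam h
  have hu : IsUnit (Matrix.single a a h - Q).det := by
    rw [hdet]; exact (mul_pos hh hD0).ne'.isUnit
  have hfac : (1 + Matrix.diagonal lam * (Matrix.single a a h - Q)⁻¹) *
      (Matrix.single a a h - Q) = Matrix.diagonal lam + (Matrix.single a a h - Q) := by
    rw [add_mul, one_mul, Matrix.mul_assoc, Matrix.nonsing_inv_mul _ hu, mul_one, add_comm]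
  have h1 := congrArg Matrix.det hfac
  rw [Matrix.det_mul, hdet, hdet'] at h1
  rw [Real.rpow_neg_one, minorRatio, lapExponent]
  rw [← hQ] at hD hD0 hN
  have h2 : 0 < killedDet Q lam + h * killedMinor Q a lam := by positivity
  have h3 := eq_div_of_mul_eq (mul_pos hh hD0).ne' h1
  rw [h3]
  have h4 : 0 < h + killedDet Q lam / killedMinor Q a lam := by positivity
  field_simp
  ring

end Laplacian

/-! ### Laplace transforms of measures: uniqueness and continuity -/

section Uniqueness

/-- Bounded continuous function `x ↦ exp (-∑ k, n k * φ k x)`, for nonnegative `φ k`. -/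
def expNegBCF {E κ : Type*} [TopologicalSpace E] [Fintype κ] (φ : κ → C(E, ℝ))
    (hφ : ∀ k x, 0 ≤ φ k x) (n : κ → ℕ) : E →ᵇ ℝ :=
  BoundedContinuousFunction.ofNormedAddCommGroup (fun x => Real.exp (-∑ k, (n k : ℝ) * φ k x))
    (by fun_prop) 1 (fun x => by
      rw [Real.norm_eq_abs, Real.abs_exp, Real.exp_le_one_iff, neg_nonpos]
      exact Finset.sum_nonneg fun k _ => mul_nonneg (Nat.cast_nonneg _) (hφ k x))

/-- The functions `expNegBCF φ hφ n` form a monoid under multiplication. -/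
def expNegSubmonoid {E κ : Type*} [TopologicalSpace E] [Fintype κ] (φ : κ → C(E, ℝ))
    (hφ : ∀ k x, 0 ≤ φ k x) : Submonoid (E →ᵇ ℝ) where
  carrier := Set.range (expNegBCF φ hφ)
  one_mem' := ⟨0, by ext x; simp [expNegBCF]⟩
  mul_mem' := by
    rintro _ _ ⟨n, rfl⟩ ⟨m, rfl⟩
    refine ⟨n + m, ?_⟩
    ext x
    simp only [expNegBCF, BoundedContinuousFunction.coe_ofNormedAddCommGroup,
      BoundedContinuousFunction.mul_apply, ← Real.exp_add]
    congr 1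
    simp only [Pi.add_apply, Nat.cast_add, add_mul, Finset.sum_add_distrib]
    ring

/-- A version of the uniqueness theorem for Laplace transforms: a finite measure is determined by
the integrals of `exp (-∑ k, n k * φ k)`, `n k ∈ ℕ`, where the nonnegative continuous functions
`φ k` separate points. -/
theorem ext_of_forall_integral_expNegBCF {E κ : Type*} [MetricSpace E] [CompleteSpace E]
    [SecondCountableTopology E] [MeasurableSpace E] [BorelSpace E] [Fintype κ] (φ : κ → C(E, ℝ))
    (hφ : ∀ k x, 0 ≤ φ k x) (hsep : ∀ x y, (∀ k, φ k x = φ k y) → x = y)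
    (μ ν : Measure E) [IsFiniteMeasure μ] [IsFiniteMeasure ν]
    (h : ∀ n, ∫ x, expNegBCF φ hφ n x ∂μ = ∫ x, expNegBCF φ hφ n x ∂ν) : μ = ν := by
  classical
  let A : StarSubalgebra ℝ (E →ᵇ ℝ) :=
    { Algebra.adjoin ℝ (expNegSubmonoid φ hφ : Set (E →ᵇ ℝ)) with
      star_mem' := fun {a} ha => by
        have : star a = a := by ext x; simp
        rw [this]; exact ha }
  refine ext_of_forall_mem_subalgebra_integral_eq_of_pseudoEMetric_complete_countable
    (𝕜 := ℝ) (A := A) ?_ ?_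
  · intro x y hxy
    obtain ⟨k, hk⟩ : ∃ k, φ k x ≠ φ k y := by
      by_contra hcon
      push Not at hcon
      exact hxy (hsep x y hcon)
    refine ⟨fun z => expNegBCF φ hφ (Pi.single k 1) z,
      ⟨(expNegBCF φ hφ (Pi.single k 1)).toContinuousMap,
        ⟨expNegBCF φ hφ (Pi.single k 1), ?_, rfl⟩, rfl⟩, ?_⟩
    · exact Algebra.subset_adjoin ⟨Pi.single k 1, rfl⟩
    · simpa [expNegBCF, Pi.single_apply] using hk
  · intro g hg
    have hg' : g ∈ Submodule.span ℝ (expNegSubmonoid φ hφ : Set (E →ᵇ ℝ)) := by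
      have h1 : g ∈ (Algebra.adjoin ℝ (expNegSubmonoid φ hφ : Set (E →ᵇ ℝ))).toSubmodule := hg
      rwa [Algebra.adjoin_eq_span, Submonoid.closure_eq] at h1
    clear hg
    induction hg' using Submodule.span_induction with
    | mem g hg =>
      obtain ⟨n, rfl⟩ := hg
      exact h n
    | zero => simp
    | add f g hf hg ihf ihg =>
      simp only [BoundedContinuousFunction.coe_add, Pi.add_apply]
      rw [integral_add (f.integrable μ) (g.integrable μ),
        integral_add (f.integrable ν) (g.integrable ν), ihf, ihg]
    | smul c f hf ih =>
      simp only [BoundedContinuousFunction.coe_smul, smul_eq_mul, integral_const_mul]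
      rw [ih]

/-- Uniqueness for Laplace transforms of finite measures carried by a closed set `C`: it suffices
that the functions `φ k` be nonnegative and separate points on `C`, and the exponents can be
restricted to natural numbers. -/
theorem ext_of_forall_integral_exp_neg {F κ : Type*} [MetricSpace F] [CompleteSpace F]
    [SecondCountableTopology F] [MeasurableSpace F] [BorelSpace F] [Fintype κ] {φ : κ → F → ℝ}
    (hcont : ∀ k, Continuous (φ k)) {C : Set F} (hC : IsClosed C) (hφ : ∀ k, ∀ x ∈ C, 0 ≤ φ k x)
    (hsep : ∀ x ∈ C, ∀ y ∈ C, (∀ k, φ k x = φ k y) → x = y)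
    (μ ν : Measure F) [IsFiniteMeasure μ] [IsFiniteMeasure ν]
    (hμ : ∀ᵐ x ∂μ, x ∈ C) (hν : ∀ᵐ x ∂ν, x ∈ C)
    (h : ∀ n : κ → ℕ, ∫ x, Real.exp (-∑ k, (n k : ℝ) * φ k x) ∂μ =
      ∫ x, Real.exp (-∑ k, (n k : ℝ) * φ k x) ∂ν) : μ = ν := by
  have hCm := hC.measurableSet
  have : CompleteSpace C := hC.completeSpace_coe
  have hfin : ∀ (ρ : Measure F) [IsFiniteMeasure ρ],
      IsFiniteMeasure (Measure.comap (Subtype.val : C → F) ρ) := by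
    intro ρ _
    refine ⟨?_⟩
    rw [comap_subtype_coe_apply hCm]
    exact measure_lt_top _ _
  have := hfin μ
  have := hfin ν
  have key : Measure.comap (Subtype.val : C → F) μ = Measure.comap Subtype.val ν := by
    refine ext_of_forall_integral_expNegBCF (κ := κ)
      (fun k => ⟨fun x : C => φ k x, (hcont k).comp continuous_subtype_val⟩)
      (fun k x => hφ k x x.2) (fun x y hxy => Subtype.ext (hsep x x.2 y y.2 hxy)) _ _ fun n => ?_
    simp only [expNegBCF, BoundedContinuousFunction.coe_ofNormedAddCommGroup, ContinuousMap.coe_mk]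
    rw [integral_subtype_comap hCm (fun x => Real.exp (-∑ k, (n k : ℝ) * φ k x)),
      integral_subtype_comap hCm (fun x => Real.exp (-∑ k, (n k : ℝ) * φ k x)),
      Measure.restrict_eq_self_of_ae_mem hμ, Measure.restrict_eq_self_of_ae_mem hν, h]
  rw [← Measure.restrict_eq_self_of_ae_mem hμ, ← Measure.restrict_eq_self_of_ae_mem hν,
    ← map_comap_subtype_coe hCm, ← map_comap_subtype_coe hCm, key]

end Uniqueness

section LaplaceTransform

variable {ι : Type*} [Fintype ι]

/-- The Laplace transform of a measure on `ℝ^ι`. It is used for measures carried by the closed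
orthant and `lam ≥ 0`, where the integrand is bounded by `1`. -/
def laplaceTransform (μ : Measure (ι → ℝ)) (lam : ι → ℝ) : ℝ :=
  ∫ x, Real.exp (-∑ i, lam i * x i) ∂μ

theorem ext_of_laplaceTransform {μ ν : Measure (ι → ℝ)} [IsFiniteMeasure μ] [IsFiniteMeasure ν]
    (hμ : ∀ᵐ x ∂μ, 0 ≤ x) (hν : ∀ᵐ x ∂ν, 0 ≤ x)
    (h : ∀ lam : ι → ℝ, 0 ≤ lam → laplaceTransform μ lam = laplaceTransform ν lam) : μ = ν :=
  ext_of_forall_integral_exp_neg (φ := fun i (x : ι → ℝ) => x i) (fun i => continuous_apply i)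
    (C := Set.Ici 0) isClosed_Ici (fun i _ hx => hx i) (fun _ _ _ _ hxy => funext hxy) μ ν hμ hν
    (fun n => h (fun i => (n i : ℝ)) (fun _ => Nat.cast_nonneg _))

/-- A family of laws on the closed orthant is tight if its Laplace transforms along the diagonal
tend to `1` at `0`, uniformly over the family. -/
theorem isTightMeasureSet_of_laplaceTransform {S : Set (Measure (ι → ℝ))}
    (hprob : ∀ μ ∈ S, IsProbabilityMeasure μ) (hS : ∀ μ ∈ S, ∀ᵐ x ∂μ, 0 ≤ x) {g : ℝ → ℝ}
    (hg : Tendsto g (𝓝[>] 0) (𝓝 1))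
    (hle : ∀ μ ∈ S, ∀ ε > 0, g ε ≤ laplaceTransform μ (fun _ => ε)) : IsTightMeasureSet S := by
  rw [isTightMeasureSet_iff_exists_isCompact_measure_compl_le]
  intro δ hδ
  obtain ⟨δ', hδ'0, hδ'⟩ : ∃ δ' : ℝ, 0 < δ' ∧ ENNReal.ofReal δ' ≤ δ := by
    rcases eq_or_ne δ ⊤ with rfl | hδt
    · exact ⟨1, one_pos, le_top⟩
    · exact ⟨δ.toReal, ENNReal.toReal_pos hδ.ne' hδt, by rw [ENNReal.ofReal_toReal hδt]⟩
  have he : 0 < 1 - Real.exp (-1) := by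
    have : Real.exp (-1) < 1 := Real.exp_lt_one_iff.2 (by norm_num)
    linarith
  have hev : ∀ᶠ ε in 𝓝[>] (0 : ℝ), 1 - δ' * (1 - Real.exp (-1)) < g ε :=
    hg.eventually (lt_mem_nhds (by nlinarith [mul_pos hδ'0 he]))
  obtain ⟨ε, hε, hε0⟩ := (hev.and self_mem_nhdsWithin).exists
  have hε0 : 0 < ε := hε0
  refine ⟨Set.Icc 0 (fun _ => ε⁻¹), isCompact_Icc, fun μ hμ => ?_⟩
  have := hprob μ hμ
  refine le_trans ?_ hδ'
  -- Markov's inequality for `1 - exp (-ε ∑ i, x i)`, which is at least `1 - exp (-1)` off the cube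
  have hsub : ∀ᵐ x ∂μ, x ∈ (Set.Icc 0 (fun _ => ε⁻¹) : Set (ι → ℝ))ᶜ →
      1 - Real.exp (-1) ≤ 1 - Real.exp (-∑ i, ε * x i) := by
    filter_upwards [hS μ hμ] with x hx hxn
    have h1 : ∃ i, ε⁻¹ < x i := by
      by_contra hcon
      push Not at hcon
      exact hxn ⟨hx, hcon⟩
    obtain ⟨i, hi⟩ := h1
    have h2 : ε * x i ≤ ∑ i, ε * x i :=
      Finset.single_le_sum (f := fun i => ε * x i)
        (fun j _ => mul_nonneg hε0.le (hx j)) (Finset.mem_univ i)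
    have h3 : 1 ≤ ε * x i := by
      rw [inv_lt_iff_one_lt_mul₀ hε0] at hi; linarith
    have : Real.exp (-∑ i, ε * x i) ≤ Real.exp (-1) := Real.exp_le_exp.2 (by linarith)
    linarith
  have hint : Integrable (fun x : ι → ℝ => Real.exp (-∑ i, ε * x i)) μ := by
    refine Integrable.of_bound (C := 1) (Continuous.aestronglyMeasurable (by fun_prop)) ?_
    filter_upwards [hS μ hμ] with x hx
    rw [Real.norm_eq_abs, Real.abs_exp, Real.exp_le_one_iff, neg_nonpos]
    exact Finset.sum_nonneg fun i _ => mul_nonneg hε0.le (hx i)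
  have hnn : 0 ≤ᵐ[μ] fun x : ι → ℝ => 1 - Real.exp (-∑ i, ε * x i) := by
    filter_upwards [hS μ hμ] with x hx
    have : Real.exp (-∑ i, ε * x i) ≤ 1 := by
      rw [Real.exp_le_one_iff, neg_nonpos]
      exact Finset.sum_nonneg fun i _ => mul_nonneg hε0.le (hx i)
    simp only [Pi.zero_apply]
    linarith
  have hmark := mul_meas_ge_le_integral_of_nonneg hnn ((integrable_const 1).sub hint)
    (1 - Real.exp (-1))
  rw [integral_sub (integrable_const 1) hint] at hmark
  simp only [integral_const, probReal_univ, one_smul] at hmark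
  have hL := hle μ hμ ε hε0
  rw [laplaceTransform] at hL
  have h5 : μ.real {x | 1 - Real.exp (-1) ≤ 1 - Real.exp (-∑ i, ε * x i)} ≤ δ' := by
    by_contra hcon
    push Not at hcon
    nlinarith [mul_lt_mul_of_pos_left hcon he]
  calc μ (Set.Icc 0 fun _ => ε⁻¹)ᶜ
      ≤ μ {x | 1 - Real.exp (-1) ≤ 1 - Real.exp (-∑ i, ε * x i)} := measure_mono_ae hsub
    _ = ENNReal.ofReal (μ.real {x | 1 - Real.exp (-1) ≤ 1 - Real.exp (-∑ i, ε * x i)}) := by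
        rw [ofReal_measureReal]
    _ ≤ ENNReal.ofReal δ' := ENNReal.ofReal_le_ofReal h5

/-- Limit points of laws on the closed orthant live on the orthant. -/
theorem ae_nonneg_of_tendsto {α : Type*} {l : Filter α} [l.NeBot]
    {ρ : α → ProbabilityMeasure (ι → ℝ)} {ρ' : ProbabilityMeasure (ι → ℝ)}
    (hlim : Tendsto ρ l (𝓝 ρ')) (hρ : ∀ n, ∀ᵐ x ∂(ρ n : Measure (ι → ℝ)), 0 ≤ x) :
    ∀ᵐ x ∂(ρ' : Measure (ι → ℝ)), 0 ≤ x := by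
  -- the bounded continuous function `min 1 (max (-x i) 0)` vanishes exactly where `0 ≤ x i`
  have hnn : ∀ i (x : ι → ℝ), 0 ≤ min 1 (max (-x i) 0) := fun i x =>
    le_min zero_le_one (le_max_right _ _)
  have h1 : ∀ i, ∀ᵐ x ∂(ρ' : Measure (ι → ℝ)), 0 ≤ x i := by
    intro i
    let f : (ι → ℝ) →ᵇ ℝ := BoundedContinuousFunction.ofNormedAddCommGroup
      (fun x => min 1 (max (-x i) 0)) (by fun_prop) 1 (fun x => by
        rw [Real.norm_eq_abs, abs_of_nonneg (hnn i x)]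
        exact min_le_left _ _)
    have h2 := (ProbabilityMeasure.tendsto_iff_forall_integral_tendsto.1 hlim) f
    have h3 : ∀ n, ∫ x, f x ∂(ρ n : Measure (ι → ℝ)) = 0 := by
      intro n
      refine integral_eq_zero_of_ae ?_
      filter_upwards [hρ n] with x hx
      have : max (-x i) 0 = 0 := max_eq_right (by have := hx i; simp at this; linarith)
      simp [f, this]
    simp only [h3] at h2
    have h4 := tendsto_nhds_unique h2 tendsto_const_nhds
    have h6 := (integral_eq_zero_iff_of_nonneg (f := f) (fun x => hnn i x) (f.integrable _)).1 h4
    filter_upwards [h6] with x hx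
    by_contra hneg
    push Not at hneg
    have h5 : 0 < min 1 (max (-x i) 0) :=
      lt_min one_pos (lt_max_of_lt_left (by linarith))
    exact h5.ne' hx
  filter_upwards [ae_all_iff.2 h1] with x hx i using hx i

theorem tendsto_laplaceTransform {α : Type*} {l : Filter α} [l.NeBot]
    {ρ : α → ProbabilityMeasure (ι → ℝ)} {ρ' : ProbabilityMeasure (ι → ℝ)}
    (hlim : Tendsto ρ l (𝓝 ρ')) (hρ : ∀ n, ∀ᵐ x ∂(ρ n : Measure (ι → ℝ)), 0 ≤ x)
    {lam : ι → ℝ} (hlam : 0 ≤ lam) :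
    Tendsto (fun n => laplaceTransform (ρ n) lam) l (𝓝 (laplaceTransform ρ' lam)) := by
  -- `exp (-⟨lam, x⟩)` is unbounded off the orthant, hence the positive parts
  let f : (ι → ℝ) →ᵇ ℝ := BoundedContinuousFunction.ofNormedAddCommGroup
    (fun x => Real.exp (-∑ i, lam i * max (x i) 0)) (by fun_prop) 1 (fun x => by
      rw [Real.norm_eq_abs, Real.abs_exp, Real.exp_le_one_iff, neg_nonpos]
      exact Finset.sum_nonneg fun i _ => mul_nonneg (hlam i) (le_max_right _ _))
  have h1 : ∀ ν : Measure (ι → ℝ), (∀ᵐ x ∂ν, 0 ≤ x) → laplaceTransform ν lam = ∫ x, f x ∂ν := by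
    intro ν hν
    refine integral_congr_ae ?_
    filter_upwards [hν] with x hx
    have : ∀ i, max (x i) 0 = x i := fun i => max_eq_left (hx i)
    simp [f, this]
  rw [h1 _ (ae_nonneg_of_tendsto hlim hρ)]
  simp only [fun n => h1 _ (hρ n)]
  exact (ProbabilityMeasure.tendsto_iff_forall_integral_tendsto.1 hlim) f

/-- Continuity theorem for Laplace transforms: a tight family of laws on the closed orthant whose
Laplace transforms converge pointwise converges weakly. -/
theorem exists_tendsto_of_laplaceTransform {α : Type*} {l : Filter α} [l.NeBot]
    {ρ : α → ProbabilityMeasure (ι → ℝ)} (hρ : ∀ n, ∀ᵐ x ∂(ρ n : Measure (ι → ℝ)), 0 ≤ x)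
    (htight : IsTightMeasureSet {(ρ n : Measure (ι → ℝ)) | n}) {L : (ι → ℝ) → ℝ}
    (hL : ∀ lam : ι → ℝ, 0 ≤ lam → Tendsto (fun n => laplaceTransform (ρ n) lam) l (𝓝 (L lam))) :
    ∃ ρ' : ProbabilityMeasure (ι → ℝ), (∀ᵐ x ∂(ρ' : Measure (ι → ℝ)), 0 ≤ x) ∧
      (∀ lam : ι → ℝ, 0 ≤ lam → laplaceTransform ρ' lam = L lam) ∧ Tendsto ρ l (𝓝 ρ') := by
  have hcomp : IsCompact (closure {ρ n | n}) :=
    isCompact_closure_of_isTightMeasureSet (by simpa using htight)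
  have hex : ∀ U : Ultrafilter α, ↑U ≤ l → ∃ ρ' : ProbabilityMeasure (ι → ℝ),
      (∀ᵐ x ∂(ρ' : Measure (ι → ℝ)), 0 ≤ x) ∧
      (∀ lam : ι → ℝ, 0 ≤ lam → laplaceTransform ρ' lam = L lam) ∧ Tendsto ρ U (𝓝 ρ') := by
    intro U hU
    obtain ⟨ρ', -, hρ' : Tendsto _ _ _⟩ := hcomp.ultrafilter_le_nhds (U.map ρ)
      (.trans (by simp) (monotone_principal subset_closure))
    have hρ'' : Tendsto ρ U (𝓝 ρ') := hρ'
    exact ⟨ρ', ae_nonneg_of_tendsto hρ'' hρ, fun lam hlam =>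
      tendsto_nhds_unique (tendsto_laplaceTransform hρ'' hρ hlam) ((hL lam hlam).mono_left hU),
      hρ''⟩
  obtain ⟨ρ', h0, h1, -⟩ := hex (Ultrafilter.of l) (Ultrafilter.of_le l)
  refine ⟨ρ', h0, h1, (tendsto_iff_ultrafilter _ _ _).2 fun U hU => ?_⟩
  obtain ⟨ρ'', h0', h1', h2'⟩ := hex U hU
  have heq : (ρ'' : Measure (ι → ℝ)) = ρ' := ext_of_laplaceTransform h0' h0 fun lam hlam =>
    (h1' lam hlam).trans (h1 lam hlam).symm
  have : ρ'' = ρ' := Subtype.ext heq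
  rwa [← this]

end LaplaceTransform

/-! ### Approximation along time grids -/

section Grid

/-- The first point of the grid `ℕ / (m + 1)` strictly to the right of `s`. -/
def upGrid (m : ℕ) (s : ℝ≥0) : ℝ≥0 := (⌊((m : ℝ≥0) + 1) * s⌋₊ + 1) / ((m : ℝ≥0) + 1)

theorem le_upGrid (m : ℕ) (s : ℝ≥0) : s ≤ upGrid m s := by
  rw [upGrid, le_div_iff₀ (by positivity), mul_comm]
  exact (Nat.lt_floor_add_one _).le

theorem upGrid_le (m : ℕ) (s : ℝ≥0) : upGrid m s ≤ s + 1 / ((m : ℝ≥0) + 1) := by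
  rw [upGrid, add_div]
  gcongr
  rw [div_le_iff₀ (by positivity), mul_comm]
  exact Nat.floor_le zero_le

theorem tendsto_upGrid (s : ℝ≥0) : Tendsto (fun m => upGrid m s) atTop (𝓝[≥] s) := by
  refine tendsto_nhdsWithin_iff.2 ⟨?_, Eventually.of_forall fun m => le_upGrid m s⟩
  refine tendsto_of_tendsto_of_tendsto_of_le_of_le tendsto_const_nhds ?_
    (fun m => le_upGrid m s) (fun m => upGrid_le m s)
  have : Tendsto (fun m : ℕ => s + 1 / ((m : ℝ≥0) + 1)) atTop (𝓝 (s + 0)) :=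
    tendsto_const_nhds.add tendsto_one_div_add_atTop_nhds_zero_nat
  simpa using this

/-- A right-continuous process with values in a discrete space is jointly measurable. -/
theorem measurable_uncurry_of_rightContinuous {ι Ω : Type*} [Countable ι] [MeasurableSpace ι]
    [DiscreteMeasurableSpace ι] [MeasurableSpace Ω] {X : ℝ≥0 → Ω → ι}
    (hX : ∀ t, Measurable (X t)) (hrc : ∀ ω t, ∀ᶠ s in 𝓝[≥] t, X s ω = X t ω) :
    Measurable (fun p : ℝ≥0 × Ω => X p.1 p.2) := by
  have hm : ∀ m : ℕ, Measurable (fun p : ℝ≥0 × Ω => X (upGrid m p.1) p.2) := by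
    intro m
    set f : ℕ → ℝ≥0 := fun n => (n + 1) / ((m : ℝ≥0) + 1) with hf
    have h1 : Measurable (fun q : ℕ × Ω => X (f q.1) q.2) := by
      refine measurable_from_prod_countable_right fun n => ?_
      exact hX (f n)
    have h2 : Measurable (fun p : ℝ≥0 × Ω => (⌊((m : ℝ≥0) + 1) * p.1⌋₊, p.2)) :=
      (Nat.measurable_floor.comp (measurable_fst.const_mul _)).prodMk measurable_snd
    have h3 : ∀ s, upGrid m s = f ⌊((m : ℝ≥0) + 1) * s⌋₊ := fun s => rfl
    simp only [h3]
    clear_value f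
    exact h1.comp h2
  refine measurable_to_countable' fun i => ?_
  have : (fun p : ℝ≥0 × Ω => X p.1 p.2) ⁻¹' {i} =
      ⋃ N : ℕ, ⋂ m : ℕ, ⋂ _ : N ≤ m, (fun p : ℝ≥0 × Ω => X (upGrid m p.1) p.2) ⁻¹' {i} := by
    ext ⟨t, ω⟩
    simp only [Set.mem_preimage, Set.mem_singleton_iff, Set.mem_iUnion, Set.mem_iInter]
    have hev := (tendsto_upGrid t).eventually (hrc ω t)
    -- by right continuity the grid values are eventually equal to the value at `t`
    rw [← eventually_atTop]
    constructor
    · rintro rfl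
      exact hev
    · intro h
      obtain ⟨m, h1, h2⟩ := (h.and hev).exists
      rw [← h1, h2]
  rw [this]
  exact MeasurableSet.iUnion fun N => MeasurableSet.iInter fun m => MeasurableSet.iInter fun _ =>
    hm m (MeasurableSet.singleton i)

end Grid

/-! ### Local times of a right-continuous path -/

section LocalTime

variable {ι : Type*} [Fintype ι] [DecidableEq ι] [MeasurableSpace ι] [DiscreteMeasurableSpace ι]

omit [DecidableEq ι] in
theorem measurable_of_rightContinuous {x : ℝ≥0 → ι} (hx : ∀ t, ∀ᶠ s in 𝓝[≥] t, x s = x t) :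
    Measurable x := by
  have h := measurable_uncurry_of_rightContinuous (Ω := Unit) (X := fun t _ => x t)
    (fun _ => measurable_const) (fun _ => hx)
  exact h.comp (measurable_id.prodMk (measurable_const (a := ())))

/-- The indicator that the path `x` occupies the state `i`, as a function of real time. -/
def occ (x : ℝ≥0 → ι) (i : ι) (s : ℝ) : ℝ := if x s.toNNReal = i then 1 else 0

omit [Fintype ι] [MeasurableSpace ι] [DiscreteMeasurableSpace ι] in
theorem occ_nonneg (x : ℝ≥0 → ι) (i : ι) (s : ℝ) : 0 ≤ occ x i s := by
  unfold occ; split_ifs <;> norm_num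

omit [Fintype ι] [MeasurableSpace ι] [DiscreteMeasurableSpace ι] in
theorem occ_le_one (x : ℝ≥0 → ι) (i : ι) (s : ℝ) : occ x i s ≤ 1 := by
  unfold occ; split_ifs <;> norm_num

variable {x : ℝ≥0 → ι} (hx : ∀ t, ∀ᶠ s in 𝓝[≥] t, x s = x t)

include hx

theorem measurable_occ (i : ι) : Measurable (occ x i) := by
  refine Measurable.ite ?_ measurable_const measurable_const
  exact ((measurable_of_rightContinuous hx).comp measurable_real_toNNReal)
    (MeasurableSet.singleton i)

theorem intervalIntegrable_occ (i : ι) (s t : ℝ) : IntervalIntegrable (occ x i) volume s t := by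
  refine (intervalIntegrable_const (c := (1 : ℝ))).mono_fun
    (measurable_occ hx i).aestronglyMeasurable (Eventually.of_forall fun s => ?_)
  simp only [Real.norm_of_nonneg (occ_nonneg x i s), norm_one]
  exact occ_le_one x i s

omit [Fintype ι] [MeasurableSpace ι] [DiscreteMeasurableSpace ι] hx in
theorem localTime_eq (t : ℝ≥0) (i : ι) : localTime x t i = ∫ s in (0 : ℝ)..t, occ x i s := rfl

theorem localTime_sub (s t : ℝ≥0) (i : ι) :
    localTime x t i - localTime x s i = ∫ u in (s : ℝ)..t, occ x i u :=
  intervalIntegral.integral_interval_sub_left (intervalIntegrable_occ hx i _ _)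
    (intervalIntegrable_occ hx i _ _)

omit [Fintype ι] [MeasurableSpace ι] [DiscreteMeasurableSpace ι] hx in
theorem localTime_zero (i : ι) : localTime x 0 i = 0 := by
  simp [localTime]

theorem monotone_localTime (i : ι) : Monotone fun t => localTime x t i := by
  intro s t hst
  have h := localTime_sub hx s t i
  have h2 : 0 ≤ ∫ u in (s : ℝ)..t, occ x i u :=
    intervalIntegral.integral_nonneg (by exact_mod_cast hst) fun u _ => occ_nonneg x i u
  simp only
  linarith

theorem localTime_nonneg (t : ℝ≥0) (i : ι) : 0 ≤ localTime x t i := by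
  have := monotone_localTime hx i (zero_le : 0 ≤ t)
  simpa [localTime_zero] using this

theorem continuous_localTime (i : ι) : Continuous fun t => localTime x t i := by
  have h : Continuous fun t : ℝ => ∫ s in (0 : ℝ)..t, occ x i s :=
    intervalIntegral.continuous_primitive (fun a b => intervalIntegrable_occ hx i a b) 0
  exact h.comp NNReal.continuous_coe

theorem sum_localTime (t : ℝ≥0) : ∑ i, localTime x t i = t := by
  simp only [localTime_eq]
  rw [← intervalIntegral.integral_finsetSum fun i _ => intervalIntegrable_occ hx i _ _]
  simp [occ]

/-- Occupation time formula. -/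
theorem sum_mul_localTime_eq (lam : ι → ℝ) (t : ℝ≥0) :
    ∑ i, lam i * localTime x t i = ∫ s in (0 : ℝ)..t, lam (x s.toNNReal) := by
  simp only [localTime_eq, ← intervalIntegral.integral_const_mul]
  rw [← intervalIntegral.integral_finsetSum fun i _ =>
    (intervalIntegrable_occ hx i _ _).const_mul _]
  simp [occ]

theorem mul_le_sum_mul_localTime {lam : ι → ℝ} {c : ℝ} (hc : ∀ i, c ≤ lam i) (t : ℝ≥0) :
    c * t ≤ ∑ i, lam i * localTime x t i := by
  rw [← sum_localTime hx t, Finset.mul_sum]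
  exact Finset.sum_le_sum fun i _ => mul_le_mul_of_nonneg_right (hc i) (localTime_nonneg hx t i)

theorem sum_mul_localTime_nonneg {lam : ι → ℝ} (hlam : 0 ≤ lam) (t : ℝ≥0) :
    0 ≤ ∑ i, lam i * localTime x t i :=
  Finset.sum_nonneg fun i _ => mul_nonneg (hlam i) (localTime_nonneg hx t i)

/-- A right-continuous path stays at its present state for a positive time, during which the local
time at `a` grows at unit speed or not at all. -/
theorem exists_localTime_eq_add (t : ℝ≥0) (a : ι) :
    ∃ ε : ℝ≥0, 0 < ε ∧ (∀ u ∈ Set.Ico t (t + ε), x u = x t) ∧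
      ∀ u ∈ Set.Icc t (t + ε), localTime x u a =
        localTime x t a + if x t = a then ((u : ℝ) - t) else 0 := by
  obtain ⟨u₀, hu₀, hsub⟩ := (mem_nhdsGE_iff_exists_Ico_subset' (show t < t + 1 by simp)).1 (hx t)
  refine ⟨u₀ - t, tsub_pos_of_lt hu₀, ?_⟩
  rw [add_tsub_cancel_of_le (le_of_lt hu₀)]
  have h1 : ∀ u ∈ Set.Ico t u₀, x u = x t := fun u hu => hsub hu
  refine ⟨h1, fun u hu => ?_⟩
  have h2 := localTime_sub hx t u a
  have h3 : ∫ v in (t : ℝ)..u, occ x a v = ∫ v in (t : ℝ)..u, if x t = a then (1 : ℝ) else 0 := by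
    refine intervalIntegral.integral_congr_Ioo_of_le (by exact_mod_cast hu.1) fun v hv => ?_
    have hv0 : 0 ≤ v := t.2.trans hv.1.le
    have h4 : x v.toNNReal = x t := by
      refine h1 _ ⟨?_, ?_⟩
      · rw [Real.le_toNNReal_iff_coe_le hv0]; exact hv.1.le
      · rw [Real.toNNReal_lt_iff_lt_coe hv0]
        exact hv.2.trans_le (by exact_mod_cast hu.2)
    simp only [occ, h4]
  rw [h3] at h2
  split_ifs at h2 ⊢ with h
  · simp at h2; linarith
  · simp at h2; linarith

omit [Fintype ι] [MeasurableSpace ι] [DiscreteMeasurableSpace ι] hx in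
/-- If the total local time at `a` stays below `r`, the inverse local time takes the junk value
`sInf ∅ = 0`. -/
theorem invLocalTime_eq_zero {a : ι} {r : ℝ} (h : ∀ n : ℕ, localTime x n a < r)
    (hmono : Monotone fun t => localTime x t a) : invLocalTime x a r = 0 := by
  have : {s : ℝ≥0 | r ≤ localTime x s a} = ∅ := by
    ext s
    simp only [Set.mem_ofPred_eq, Set.mem_empty_iff_false, iff_false, not_le]
    obtain ⟨n, hn⟩ := exists_nat_ge s
    exact (hmono hn).trans_lt (h n)
  rw [invLocalTime, this]
  simp

theorem le_localTime_invLocalTime {a : ι} {r : ℝ} (h : ∃ n : ℕ, r ≤ localTime x n a) :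
    r ≤ localTime x (invLocalTime x a r) a := by
  have hclosed : IsClosed {s : ℝ≥0 | r ≤ localTime x s a} :=
    isClosed_le continuous_const (continuous_localTime hx a)
  obtain ⟨n, hn⟩ := h
  exact hclosed.csInf_mem ⟨n, hn⟩ (OrderBot.bddBelow _)

theorem invLocalTime_le_iff {a : ι} {r : ℝ} (h : ∃ n : ℕ, r ≤ localTime x n a) (t : ℝ≥0) :
    invLocalTime x a r ≤ t ↔ r ≤ localTime x t a := by
  constructor
  · intro h1
    exact (le_localTime_invLocalTime hx h).trans (monotone_localTime hx a h1)
  · intro h1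
    exact csInf_le (OrderBot.bddBelow _) h1

theorem invLocalTime_mono {a : ι} {r r' : ℝ} (hr : r ≤ r')
    (h : ∃ n : ℕ, r' ≤ localTime x n a) : invLocalTime x a r ≤ invLocalTime x a r' := by
  have h' : ∃ n : ℕ, r ≤ localTime x n a := h.imp fun n hn => hr.trans hn
  rw [invLocalTime_le_iff hx h']
  exact hr.trans (le_localTime_invLocalTime hx h)

omit [Fintype ι] [MeasurableSpace ι] [DiscreteMeasurableSpace ι] hx in
theorem invLocalTime_zero (a : ι) : invLocalTime x a 0 = 0 := by
  refine le_antisymm (csInf_le (OrderBot.bddBelow _) ?_) zero_le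
  simp [localTime_zero]

omit hx in
theorem measurable_localTime {Ω : Type*} [MeasurableSpace Ω] {X : ℝ≥0 → Ω → ι}
    (hX : ∀ t, Measurable (X t)) (hrc : ∀ ω t, ∀ᶠ s in 𝓝[≥] t, X s ω = X t ω) (i : ι) :
    Measurable (fun p : ℝ≥0 × Ω => localTime (fun t => X t p.2) p.1 i) := by
  refine measurable_uncurry_of_continuous_of_measurable
    (u := fun (t : ℝ≥0) (ω : Ω) => localTime (fun t => X t ω) t i)
    (fun ω => continuous_localTime (hrc ω) i) fun t => ?_
  have h1 : Measurable (fun p : Ω × ℝ => occ (fun t => X t p.1) i p.2) := by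
    refine Measurable.ite ?_ measurable_const measurable_const
    exact ((measurable_uncurry_of_rightContinuous hX hrc).comp
      ((measurable_real_toNNReal.comp measurable_snd).prodMk measurable_fst))
      (MeasurableSet.singleton i)
  have h2 : ∀ ω, localTime (fun t => X t ω) t i =
      ∫ s in Set.Ioc (0 : ℝ) t, occ (fun t => X t ω) i s := fun ω =>
    intervalIntegral.integral_of_le t.2
  simp only [h2]
  exact h1.stronglyMeasurable.integral_prod_right'.measurable

omit hx in
/-- Joint measurability of the inverse local time. The sublevel sets include the points where the
total local time at `a` stays below the level, because `sInf ∅ = 0`. -/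
theorem measurable_invLocalTime {Ω : Type*} [MeasurableSpace Ω] {X : ℝ≥0 → Ω → ι}
    (hX : ∀ t, Measurable (X t)) (hrc : ∀ ω t, ∀ᶠ s in 𝓝[≥] t, X s ω = X t ω) (a : ι) :
    Measurable (fun p : ℝ × Ω => invLocalTime (fun t => X t p.2) a p.1) := by
  have hA : ∀ t : ℝ≥0, Measurable (fun ω => localTime (fun t => X t ω) t a) := fun t =>
    (measurable_localTime hX hrc a).comp (measurable_const.prodMk measurable_id)
  refine measurable_of_Iic fun t => ?_
  have : (fun p : ℝ × Ω => invLocalTime (fun t => X t p.2) a p.1) ⁻¹' Set.Iic t =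
      {p | p.1 ≤ localTime (fun t => X t p.2) t a} ∪
        ⋂ n : ℕ, {p | localTime (fun t => X t p.2) n a < p.1} := by
    ext ⟨r, ω⟩
    simp only [Set.mem_preimage, Set.mem_Iic, Set.mem_union, Set.mem_ofPred_eq, Set.mem_iInter]
    by_cases h : ∃ n : ℕ, r ≤ localTime (fun t => X t ω) n a
    · rw [invLocalTime_le_iff (hrc ω) h]
      obtain ⟨n, hn⟩ := h
      constructor
      · exact Or.inl
      · rintro (h | h)
        · exact h
        · exact absurd (h n) (not_lt.2 hn)
    · push Not at h
      rw [invLocalTime_eq_zero h (monotone_localTime (hrc ω) a)]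
      simp [h]
  rw [this]
  refine (measurableSet_le measurable_fst ((hA t).comp measurable_snd)).union
    (MeasurableSet.iInter fun n => measurableSet_lt ((hA n).comp measurable_snd) measurable_fst)

omit hx in
theorem measurable_localTime_invLocalTime {Ω : Type*} [MeasurableSpace Ω] {X : ℝ≥0 → Ω → ι}
    (hX : ∀ t, Measurable (X t)) (hrc : ∀ ω t, ∀ᶠ s in 𝓝[≥] t, X s ω = X t ω) (a : ι) :
    Measurable (fun p : ℝ × Ω =>
      localTime (fun t => X t p.2) (invLocalTime (fun t => X t p.2) a p.1)) :=
  measurable_pi_iff.2 fun i => (measurable_localTime hX hrc i).comp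
    ((measurable_invLocalTime hX hrc a).prodMk measurable_snd)

end LocalTime

/-! ### Time change by the local time at a state -/

section TimeChange

variable {ι : Type*} [Fintype ι] [DecidableEq ι] [MeasurableSpace ι] [DiscreteMeasurableSpace ι]
  {x : ℝ≥0 → ι} (hx : ∀ t, ∀ᶠ s in 𝓝[≥] t, x s = x t)

include hx

/-- `exp (-⟨lam, L⟩)` for the local times of the path `x`, evaluated at the inverse local time. -/
def expLocalTimeInv (x : ℝ≥0 → ι) (a : ι) (lam : ι → ℝ) (r : ℝ) : ℝ :=
  Real.exp (-∑ i, lam i * localTime x (invLocalTime x a r) i)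

omit hx [MeasurableSpace ι] [DiscreteMeasurableSpace ι] in
theorem expLocalTimeInv_pos (a : ι) (lam : ι → ℝ) (r : ℝ) : 0 < expLocalTimeInv x a lam r :=
  Real.exp_pos _

theorem expLocalTimeInv_le_one (a : ι) {lam : ι → ℝ} (hlam : 0 ≤ lam) (r : ℝ) :
    expLocalTimeInv x a lam r ≤ 1 := by
  rw [expLocalTimeInv, Real.exp_le_one_iff, neg_nonpos]
  exact sum_mul_localTime_nonneg hx hlam _

omit hx in
theorem measurable_expLocalTimeInv {Ω : Type*} [MeasurableSpace Ω] {X : ℝ≥0 → Ω → ι}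
    (hX : ∀ t, Measurable (X t)) (hrc : ∀ ω t, ∀ᶠ s in 𝓝[≥] t, X s ω = X t ω) (a : ι)
    (lam : ι → ℝ) :
    Measurable (fun p : ℝ × Ω => expLocalTimeInv (fun t => X t p.2) a lam p.1) := by
  refine Real.measurable_exp.comp (Measurable.neg (Finset.measurable_sum _ fun i _ => ?_))
  exact ((measurable_pi_iff.1 (measurable_localTime_invLocalTime hX hrc a)) i).const_mul _

theorem measurable_expLocalTimeInv_path (a : ι) (lam : ι → ℝ) :
    Measurable (expLocalTimeInv x a lam) := by
  have h : Measurable (fun p : ℝ × Unit => expLocalTimeInv x a lam p.1) :=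
    measurable_expLocalTimeInv (Ω := Unit) (X := fun t _ => x t)
      (fun _ => measurable_const) (fun _ => hx) a lam
  have h' : Measurable (fun r : ℝ => (r, ())) := by fun_prop
  have heq : expLocalTimeInv x a lam =
      (fun p : ℝ × Unit => expLocalTimeInv x a lam p.1) ∘ fun r => (r, ()) := rfl
  rw [heq]
  exact Measurable.comp h h'

theorem exp_mul_expLocalTimeInv_le_one (a : ι) {lam : ι → ℝ} (hlam : 0 ≤ lam) {θ : ℝ}
    (hθ : 0 ≤ θ) {r : ℝ} (hr : 0 ≤ r) :
    ‖Real.exp (-θ * r) * expLocalTimeInv x a lam r‖ ≤ 1 := by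
  rw [Real.norm_of_nonneg (mul_nonneg (Real.exp_pos _).le (expLocalTimeInv_pos a lam r).le)]
  refine mul_le_one₀ ?_ (expLocalTimeInv_pos a lam r).le (expLocalTimeInv_le_one hx a hlam r)
  rw [Real.exp_le_one_iff]
  nlinarith [mul_nonneg hθ hr]

theorem intervalIntegrable_expLocalTimeInv (a : ι) {lam : ι → ℝ} (hlam : 0 ≤ lam) {θ : ℝ}
    (hθ : 0 ≤ θ) {r s : ℝ} (hr : 0 ≤ r) (hs : 0 ≤ s) :
    IntervalIntegrable (fun r => Real.exp (-θ * r) * expLocalTimeInv x a lam r) volume r s := by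
  have hmeas : Measurable fun r => Real.exp (-θ * r) * expLocalTimeInv x a lam r :=
    (by fun_prop : Measurable fun r => Real.exp (-θ * r)).mul
      (measurable_expLocalTimeInv_path hx a lam)
  rw [intervalIntegrable_iff]
  refine Measure.integrableOn_of_bounded (M := 1) (by simp) hmeas.aestronglyMeasurable ?_
  refine (ae_restrict_iff' measurableSet_uIoc).2 (Eventually.of_forall fun u hu => ?_)
  refine exp_mul_expLocalTimeInv_le_one hx a hlam hθ ?_
  exact (le_min hr hs).trans hu.1.le

/-- The weight `1{x_s = a} exp (-θ L_s^a - ⟨lam, L_s⟩)` along the path `x`. -/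
def occWeight (x : ℝ≥0 → ι) (a : ι) (lam : ι → ℝ) (θ : ℝ) (s : ℝ) : ℝ :=
  occ x a s * Real.exp (-θ * localTime x s.toNNReal a - ∑ i, lam i * localTime x s.toNNReal i)

theorem measurable_occWeight (a : ι) (lam : ι → ℝ) (θ : ℝ) : Measurable (occWeight x a lam θ) := by
  refine (measurable_occ hx a).mul (Continuous.measurable ?_)
  have h : ∀ i, Continuous fun s : ℝ => localTime x s.toNNReal i := fun i =>
    (continuous_localTime hx i).comp continuous_real_toNNReal
  have := h a
  fun_prop

theorem norm_occWeight_le (a : ι) {lam : ι → ℝ} {c : ℝ} (hc0 : 0 ≤ c) (hc : ∀ i, c ≤ lam i)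
    {θ : ℝ} (hθ : 0 ≤ θ) (s : ℝ) : ‖occWeight x a lam θ s‖ ≤ Real.exp (-c * s) := by
  rw [occWeight, norm_mul, Real.norm_of_nonneg (occ_nonneg x a s),
    Real.norm_of_nonneg (Real.exp_pos _).le]
  refine (mul_le_of_le_one_left (Real.exp_pos _).le (occ_le_one x a s)).trans ?_
  rw [Real.exp_le_exp]
  have h1 := mul_le_sum_mul_localTime hx hc s.toNNReal
  have h2 := mul_nonneg hθ (localTime_nonneg hx s.toNNReal a)
  have h3 : s ≤ s.toNNReal := Real.le_coe_toNNReal s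
  nlinarith [mul_le_mul_of_nonneg_left h3 hc0]

theorem intervalIntegrable_occWeight (a : ι) {lam : ι → ℝ} (hlam : 0 ≤ lam)
    {θ : ℝ} (hθ : 0 ≤ θ) (s t : ℝ) : IntervalIntegrable (occWeight x a lam θ) volume s t := by
  refine (intervalIntegrable_const (c := (1 : ℝ))).mono_fun
    (measurable_occWeight hx a lam θ).aestronglyMeasurable (Eventually.of_forall fun u => ?_)
  have := norm_occWeight_le hx a le_rfl (fun i => hlam i) hθ u
  simpa using this

/-- On a right neighbourhood of a time `t` spent at `a`, the inverse local time inverts the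
local time at `a`. -/
theorem invLocalTime_localTime_eq {a : ι} {t ε : ℝ≥0}
    (h : ∀ u ∈ Set.Icc t (t + ε), localTime x u a = localTime x t a + ((u : ℝ) - t))
    {u : ℝ≥0} (hu : u ∈ Set.Ioc t (t + ε)) : invLocalTime x a (localTime x u a) = u := by
  refine IsLeast.csInf_eq ⟨le_refl (localTime x u a), fun s hs => ?_⟩
  by_contra hlt
  push Not at hlt
  have hs : localTime x u a ≤ localTime x s a := hs
  have hu' := h u ⟨hu.1.le, hu.2⟩
  have htu : (t : ℝ) < u := by exact_mod_cast hu.1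
  have hsu : (s : ℝ) < u := by exact_mod_cast hlt
  rcases le_total t s with hts | hst
  · have := h s ⟨hts, hlt.le.trans hu.2⟩
    linarith
  · have := monotone_localTime hx a hst
    simp only at this
    linarith

/-- Time change by the local time at `a`. Both sides are continuous in `T`, and on a right
neighbourhood of each `T` their difference is constant. -/
theorem integral_expLocalTimeInv_eq_integral_occWeight (a : ι) {lam : ι → ℝ} (hlam : 0 ≤ lam)
    {θ : ℝ} (hθ : 0 ≤ θ) (T : ℝ≥0) :
    ∫ r in (0 : ℝ)..localTime x T a, Real.exp (-θ * r) * expLocalTimeInv x a lam r =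
      ∫ s in (0 : ℝ)..T, occWeight x a lam θ s := by
  set g : ℝ → ℝ := fun r => Real.exp (-θ * r) * expLocalTimeInv x a lam r with hg
  set A : ℝ → ℝ := fun t => localTime x t.toNNReal a with hA
  have hA0 : ∀ t, 0 ≤ A t := fun t => localTime_nonneg hx _ a
  have hAc : Continuous A := (continuous_localTime hx a).comp continuous_real_toNNReal
  set d : ℝ → ℝ := fun t => (∫ r in (0 : ℝ)..A t, g r) - ∫ s in (0 : ℝ)..t, occWeight x a lam θ s
    with hd
  have hgi : ∀ {r s : ℝ}, 0 ≤ r → 0 ≤ s → IntervalIntegrable g volume r s := fun hr hs =>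
    intervalIntegrable_expLocalTimeInv hx a hlam hθ hr hs
  have hcont : ContinuousOn d (Set.Icc 0 T) := by
    refine ContinuousOn.sub ?_ ?_
    · have h1 : ContinuousOn (fun r => ∫ u in (0 : ℝ)..r, g u) (Set.Icc 0 (A T)) := by
        have := intervalIntegral.continuousOn_primitive_interval (f := g) (μ := volume) (a := 0)
          (b := A T) ((intervalIntegrable_iff_integrableOn_Icc_of_le (hA0 T)).1
            (hgi le_rfl (hA0 T)) |>.mono_set (by rw [Set.uIcc_of_le (hA0 T)]))
        rwa [Set.uIcc_of_le (hA0 T)] at this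
      refine h1.comp hAc.continuousOn fun t ht => ⟨hA0 t, ?_⟩
      exact monotone_localTime hx a (Real.toNNReal_le_toNNReal ht.2)
    · exact (intervalIntegral.continuous_primitive
        (fun s t => intervalIntegrable_occWeight hx a hlam hθ s t) 0).continuousOn
  have hderiv : ∀ t ∈ Set.Ico (0 : ℝ) T, HasDerivWithinAt d 0 (Set.Ici t) t := by
    intro t ht
    obtain ⟨t', rfl⟩ : ∃ t' : ℝ≥0, (t' : ℝ) = t := ⟨⟨t, ht.1⟩, rfl⟩
    obtain ⟨ε, hε, hxε, hLε⟩ := exists_localTime_eq_add hx t' a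
    have hconst : ∀ u : ℝ≥0, u ∈ Set.Icc t' (t' + ε) → d u = d t' := by
      intro u hu
      have htu : (t' : ℝ) ≤ u := by exact_mod_cast hu.1
      have e1 : d u - d t' = (∫ r in A t'..A u, g r) - ∫ s in (t' : ℝ)..u, occWeight x a lam θ s := by
        simp only [hd]
        rw [← intervalIntegral.integral_interval_sub_left (hgi le_rfl (hA0 u))
            (hgi le_rfl (hA0 t')),
          ← intervalIntegral.integral_interval_sub_left
            (intervalIntegrable_occWeight hx a hlam hθ 0 u)
            (intervalIntegrable_occWeight hx a hlam hθ 0 t')]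
        ring
      suffices h : (∫ r in A t'..A u, g r) = ∫ s in (t' : ℝ)..u, occWeight x a lam θ s by
        rw [h, sub_self] at e1; linarith
      have hAu : A u = A t' + if x t' = a then ((u : ℝ) - t') else 0 := by
        simp only [hA, Real.toNNReal_coe]
        exact hLε u hu
      by_cases hxa : x t' = a
      -- at `a`, the local time grows at unit speed: substitute `r = s + (A t' - t')`
      · rw [if_pos hxa] at hAu
        have hLε' : ∀ v ∈ Set.Icc t' (t' + ε),
            localTime x v a = localTime x t' a + ((v : ℝ) - t') := fun v hv => by
          rw [hLε v hv, if_pos hxa]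
        have h1 := intervalIntegral.integral_comp_add_right (a := (t' : ℝ)) (b := u) g (A t' - t')
        rw [show (t' : ℝ) + (A t' - t') = A t' by ring,
          show (u : ℝ) + (A t' - t') = A u by rw [hAu]; ring] at h1
        rw [← h1]
        refine intervalIntegral.integral_congr_Ioo_of_le htu fun s hs => ?_
        obtain ⟨s', rfl⟩ : ∃ s' : ℝ≥0, (s' : ℝ) = s :=
          ⟨⟨s, t'.2.trans hs.1.le⟩, rfl⟩
        have hs1 : t' < s' := by exact_mod_cast hs.1
        have hs2 : s' < u := by exact_mod_cast hs.2
        have h2 : (s' : ℝ) + (A t' - t') = localTime x s' a := by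
          rw [hLε' s' ⟨hs1.le, hs2.le.trans hu.2⟩]
          simp only [hA, Real.toNNReal_coe]
          ring
        have h3 : occ x a s' = 1 := by
          rw [occ, Real.toNNReal_coe, hxε s' ⟨hs1.le, hs2.trans_le hu.2⟩, if_pos hxa]
        rw [h2]
        simp only [hg, occWeight, h3, one_mul, Real.toNNReal_coe, expLocalTimeInv,
          invLocalTime_localTime_eq hx hLε' ⟨hs1, hs2.le.trans hu.2⟩, ← Real.exp_add]
        rfl
      -- away from `a`, both increments vanish
      · rw [if_neg hxa, add_zero] at hAu
        rw [hAu, intervalIntegral.integral_same]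
        symm
        have h4 : ∫ s in (t' : ℝ)..u, occWeight x a lam θ s = ∫ s in (t' : ℝ)..u, (0 : ℝ) := by
          refine intervalIntegral.integral_congr_Ioo_of_le htu fun s hs => ?_
          obtain ⟨s', rfl⟩ : ∃ s' : ℝ≥0, (s' : ℝ) = s :=
            ⟨⟨s, t'.2.trans hs.1.le⟩, rfl⟩
          have hs1 : t' < s' := by exact_mod_cast hs.1
          have hs2 : s' < u := by exact_mod_cast hs.2
          simp only [occWeight, occ, Real.toNNReal_coe]
          rw [hxε s' ⟨hs1.le, hs2.trans_le hu.2⟩, if_neg hxa, zero_mul]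
        rw [h4]; simp
    have hev : d =ᶠ[𝓝[≥] (t' : ℝ)] fun _ => d t' := by
      have hmem : Set.Icc (t' : ℝ) (t' + ε) ∈ 𝓝[≥] (t' : ℝ) :=
        Icc_mem_nhdsGE (by simpa using hε)
      filter_upwards [hmem] with u hu
      obtain ⟨u', rfl⟩ : ∃ u' : ℝ≥0, (u' : ℝ) = u := ⟨⟨u, t'.2.trans hu.1⟩, rfl⟩
      exact hconst u' ⟨by exact_mod_cast hu.1, by exact_mod_cast hu.2⟩
    exact (hasDerivWithinAt_const _ _ _).congr_of_eventuallyEq hev rfl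
  have h5 := constant_of_has_deriv_right_zero hcont hderiv T ⟨T.2, le_rfl⟩
  simp only [hd, hA, Real.toNNReal_coe, Real.toNNReal_zero, localTime_zero,
    intervalIntegral.integral_same, sub_zero] at h5
  linarith

/-- Time change by the local time at `a`, over the whole path. The indicator discards the levels
`r` beyond the total local time at `a`, where `invLocalTime` has a junk value. -/
theorem integral_indicator_expLocalTimeInv (a : ι) {lam : ι → ℝ} {c : ℝ} (hc0 : 0 < c)
    (hc : ∀ i, c ≤ lam i) {θ : ℝ} (hθ : 0 < θ) :
    ∫ r in Set.Ioi (0 : ℝ), {r | ∃ n : ℕ, r ≤ localTime x n a}.indicator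
        (fun r => Real.exp (-θ * r) * expLocalTimeInv x a lam r) r =
      ∫ s in Set.Ioi (0 : ℝ), occWeight x a lam θ s := by
  have hlam : 0 ≤ lam := fun i => hc0.le.trans (hc i)
  set g : ℝ → ℝ := fun r => Real.exp (-θ * r) * expLocalTimeInv x a lam r with hg
  have hgm : Measurable g := (by fun_prop : Measurable fun r => Real.exp (-θ * r)).mul
      (measurable_expLocalTimeInv_path hx a lam)
  have hR : Tendsto (fun n : ℕ => ∫ s in (0 : ℝ)..n, occWeight x a lam θ s) atTop
      (𝓝 (∫ s in Set.Ioi (0 : ℝ), occWeight x a lam θ s)) := by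
    refine intervalIntegral_tendsto_integral_Ioi 0 ?_ tendsto_natCast_atTop_atTop
    refine (exp_neg_integrableOn_Ioi 0 hc0).mono'
      (measurable_occWeight hx a lam θ).aestronglyMeasurable (Eventually.of_forall fun s => ?_)
    exact norm_occWeight_le hx a hc0.le hc hθ.le s
  have hLn : ∀ n : ℕ, ∫ s in (0 : ℝ)..n, occWeight x a lam θ s =
      ∫ r in Set.Ioi (0 : ℝ), {r | r ≤ localTime x n a}.indicator g r := by
    intro n
    have h1 := integral_expLocalTimeInv_eq_integral_occWeight hx a hlam hθ.le n
    rw [NNReal.coe_natCast] at h1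
    rw [← h1, intervalIntegral.integral_of_le (localTime_nonneg hx _ a),
      setIntegral_indicator (measurableSet_le measurable_id' measurable_const)]
    rfl
  simp only [hLn] at hR
  refine tendsto_nhds_unique ?_ hR
  refine tendsto_integral_of_dominated_convergence (fun r => Real.exp (-θ * r)) ?_
    (exp_neg_integrableOn_Ioi 0 hθ) ?_ ?_
  · intro n
    exact (hgm.indicator (measurableSet_le measurable_id measurable_const)).aestronglyMeasurable
  · intro n
    refine Eventually.of_forall fun r => ?_
    refine (norm_indicator_le_norm_self _ _).trans ?_
    simp only [hg, norm_mul, Real.norm_of_nonneg (Real.exp_pos _).le,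
      Real.norm_of_nonneg (expLocalTimeInv_pos a lam r).le]
    exact mul_le_of_le_one_right (Real.exp_pos _).le (expLocalTimeInv_le_one hx a hlam r)
  · refine Eventually.of_forall fun r => ?_
    refine tendsto_const_nhds.congr' ?_
    by_cases h : ∃ n : ℕ, r ≤ localTime x n a
    · obtain ⟨n, hn⟩ := h
      filter_upwards [eventually_ge_atTop n] with m hm
      have hm' : r ≤ localTime x m a :=
        hn.trans (monotone_localTime hx a (by exact_mod_cast hm))
      rw [Set.indicator_of_mem (show r ∈ {r | r ≤ localTime x m a} from hm'),
        Set.indicator_of_mem (show r ∈ {r | ∃ n : ℕ, r ≤ localTime x n a} from ⟨n, hn⟩)]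
    · refine Eventually.of_forall fun m => ?_
      beta_reduce
      rw [Set.indicator_of_notMem (show r ∉ {r | ∃ n : ℕ, r ≤ localTime x n a} from h),
        Set.indicator_of_notMem (s := {r | r ≤ localTime x m a}) (a := r) (fun hm => h ⟨m, hm⟩) g]

end TimeChange

/-! ### The Markov property along a time grid -/

section GridMarkov

variable {ι Ω : Type*} [Fintype ι] [DecidableEq ι] [MeasurableSpace ι] [DiscreteMeasurableSpace ι]
  [MeasurableSpace Ω]

theorem integral_comp_mul_indicator {κ : Type*} [Fintype κ] [MeasurableSpace κ]
    [DiscreteMeasurableSpace κ] {μ : Measure Ω} [IsFiniteMeasure μ] {Y : Ω → κ} (hY : Measurable Y)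
    (G : κ → ℝ) {S : Set Ω} (hS : MeasurableSet S) :
    ∫ ω, G (Y ω) * S.indicator 1 ω ∂μ = ∑ p, G p * μ.real ({ω | Y ω = p} ∩ S) := by
  classical
  have h1 : ∀ ω, G (Y ω) * S.indicator 1 ω =
      ∑ p, G p * ({ω | Y ω = p} ∩ S).indicator (1 : Ω → ℝ) ω := by
    intro ω
    rw [Finset.sum_eq_single (Y ω)]
    · by_cases h : ω ∈ S <;> simp [h]
    · intro p _ hp
      rw [Set.indicator_of_notMem (fun h => hp h.1.symm), mul_zero]
    · simp
  have hm : ∀ p, MeasurableSet ({ω | Y ω = p} ∩ S) := fun p =>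
    (hY (MeasurableSet.singleton p)).inter hS
  simp only [h1]
  rw [integral_finsetSum]
  · refine Finset.sum_congr rfl fun p _ => ?_
    rw [integral_const_mul, integral_indicator_one (hm p)]
  · intro p _
    exact ((integrable_const (1 : ℝ)).indicator (hm p)).const_mul _

/-- Markov property at the points of a time grid. -/
theorem IsMarkovChain.integral_mul_indicator {μ : Measure Ω} [IsFiniteMeasure μ]
    {Q : Matrix ι ι ℝ} {a : ι} {X : ℝ≥0 → Ω → ι} (hX : IsMarkovChain μ Q a X) {t : ℕ → ℝ≥0}
    (ht : Monotone t) (n : ℕ) (G : (Fin (n + 1) → ι) → ℝ) (j : ι) :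
    ∫ ω, G (fun k => X (t k) ω) * {ω | X (t (n + 1)) ω = j}.indicator 1 ω ∂μ =
      ∫ ω, G (fun k => X (t k) ω) *
        NormedSpace.exp (((t (n + 1) : ℝ) - t n) • Q) (X (t n) ω) j ∂μ := by
  have hY : Measurable fun ω => fun k : Fin (n + 1) => X (t k) ω :=
    measurable_pi_iff.2 fun k => hX.measurable _
  have hS : MeasurableSet {ω | X (t (n + 1)) ω = j} := hX.measurable _ (MeasurableSet.singleton j)
  rw [integral_comp_mul_indicator hY G hS]
  have h2 := integral_comp_mul_indicator (μ := μ) hY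
    (fun p => G p * NormedSpace.exp (((t (n + 1) : ℝ) - t n) • Q) (p (Fin.last n)) j)
    MeasurableSet.univ
  simp only [Set.indicator_univ, Pi.one_apply, mul_one, Set.inter_univ, Fin.val_last] at h2
  rw [h2]
  refine Finset.sum_congr rfl fun p _ => ?_
  have h3 := hX.finiteDimensional n (fun k => t k) (fun k l hkl => ht hkl) p
  have h4 := hX.finiteDimensional (n + 1) (fun k => t k) (fun k l hkl => ht hkl)
    (Fin.snoc p j : Fin (n + 2) → ι)
  have hset : {ω | (fun k : Fin (n + 1) => X (t k) ω) = p} ∩ {ω | X (t (n + 1)) ω = j} =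
      {ω | ∀ k : Fin (n + 2), X (t k) ω = (Fin.snoc p j : Fin (n + 2) → ι) k} := by
    ext ω
    simp only [Set.mem_inter_iff, Set.mem_ofPred_eq, funext_iff, Fin.forall_fin_succ',
      Fin.snoc_castSucc, Fin.snoc_last, Fin.val_castSucc, Fin.val_last]
  have hset' : {ω | (fun k : Fin (n + 1) => X (t k) ω) = p} =
      {ω | ∀ k : Fin (n + 1), X (t k) ω = p k} := by
    ext ω; simp only [Set.mem_ofPred_eq, funext_iff]
  have h0 : (Fin.snoc p j : Fin (n + 2) → ι) 0 = p 0 := by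
    rw [← Fin.castSucc_zero, Fin.snoc_castSucc]
  rw [hset, hset', h3, h4, Fin.prod_univ_castSucc, h0]
  have h5 : ∀ k : Fin n, (Fin.snoc p j : Fin (n + 2) → ι) k.castSucc.succ = p k.succ := by
    intro k
    rw [← Fin.castSucc_succ, Fin.snoc_castSucc]
  simp only [Fin.succ_last, Fin.snoc_castSucc, Fin.snoc_last, h5, Fin.val_succ, Fin.val_castSucc,
    Fin.val_last, Fin.val_zero]
  ring

omit [DiscreteMeasurableSpace ι] in
theorem IsMarkovChain.measureReal_start {μ : Measure Ω} [IsProbabilityMeasure μ]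
    {Q : Matrix ι ι ℝ} {a : ι} {X : ℝ≥0 → Ω → ι} (hX : IsMarkovChain μ Q a X) (i : ι) :
    μ.real {ω | X 0 ω = i} = (1 : Matrix ι ι ℝ) a i := by
  have h := hX.finiteDimensional 0 (fun _ => 0) (fun _ _ _ => le_rfl) (fun _ => i)
  simpa using h

/-- The grid point `k / (m + 1)`. -/
def gridPt (m k : ℕ) : ℝ≥0 := k / ((m : ℝ≥0) + 1)

theorem gridPt_zero (m : ℕ) : gridPt m 0 = 0 := by simp [gridPt]

theorem gridPt_succ (m k : ℕ) : gridPt m (k + 1) = gridPt m k + 1 / ((m : ℝ≥0) + 1) := by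
  simp [gridPt, add_div]

theorem monotone_gridPt (m : ℕ) : Monotone (gridPt m) := by
  intro k l hkl
  unfold gridPt
  gcongr

/-- The index of the grid point `upGrid m s`. -/
def gridIdx (m : ℕ) (s : ℝ≥0) : ℕ := ⌊((m : ℝ≥0) + 1) * s⌋₊ + 1

theorem upGrid_eq (m : ℕ) (s : ℝ≥0) : upGrid m s = gridPt m (gridIdx m s) := by
  simp [upGrid, gridPt, gridIdx]

theorem gridIdx_add (m : ℕ) (s : ℝ≥0) :
    gridIdx m (s + 1 / ((m : ℝ≥0) + 1)) = gridIdx m s + 1 := by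
  have : ((m : ℝ≥0) + 1) * (s + 1 / ((m : ℝ≥0) + 1)) = ((m : ℝ≥0) + 1) * s + 1 := by
    field_simp
  rw [gridIdx, this, Nat.floor_add_one zero_le, gridIdx]

theorem gridIdx_eq {m k : ℕ} {s : ℝ≥0} (h1 : gridPt m k ≤ s) (h2 : s < gridPt m (k + 1)) :
    gridIdx m s = k + 1 := by
  rw [gridIdx, Nat.add_right_cancel_iff, Nat.floor_eq_iff zero_le]
  rw [gridPt, div_le_iff₀ (by positivity)] at h1
  rw [gridPt, lt_div_iff₀ (by positivity)] at h2
  constructor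
  · rwa [mul_comm]
  · rw [mul_comm]; exact_mod_cast h2

theorem measurable_gridIdx (m : ℕ) : Measurable (gridIdx m) :=
  (Measurable.of_discrete (f := fun n : ℕ => n + 1)).comp
    (Nat.measurable_floor.comp (measurable_id.const_mul ((m : ℝ≥0) + 1)))

/-- Riemann sum, along the right endpoints of the grid, of the potential `V` along the path `x`. -/
def riemannSum (V : ι → ℝ) (m : ℕ) (x : ℝ≥0 → ι) (n : ℕ) : ℝ :=
  ((m : ℝ) + 1)⁻¹ * ∑ k ∈ Finset.range n, V (x (gridPt m (k + 1)))

/-- The mass at `j`, after `n` grid steps, of the chain killed at rate `V` along the grid: the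
expectation of `exp (-riemannSum)` on the event that the chain is at `j`. -/
def gridMass (μ : Measure Ω) (V : ι → ℝ) (X : ℝ≥0 → Ω → ι) (m n : ℕ) (j : ι) : ℝ :=
  ∫ ω, Real.exp (-riemannSum V m (fun t => X t ω) n) *
    {ω | X (gridPt m n) ω = j}.indicator 1 ω ∂μ

/-- One step of the killed chain on the grid: a transition over a time `1 / (m + 1)`, followed by
killing at the new state. -/
def gridStep (Q : Matrix ι ι ℝ) (V : ι → ℝ) (m : ℕ) : Matrix ι ι ℝ := fun i j =>
  NormedSpace.exp (((m : ℝ) + 1)⁻¹ • Q) i j * Real.exp (-((m : ℝ) + 1)⁻¹ * V j)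

variable {μ : Measure Ω} [IsProbabilityMeasure μ] {Q : Matrix ι ι ℝ} {a : ι} {X : ℝ≥0 → Ω → ι}
  (hX : IsMarkovChain μ Q a X) {V : ι → ℝ}

omit [Fintype ι] [DecidableEq ι] in
theorem measurable_riemannSum (hXm : ∀ t, Measurable (X t)) (V : ι → ℝ) (m n : ℕ) :
    Measurable fun ω => riemannSum V m (fun t => X t ω) n :=
  (Finset.measurable_sum _ fun _ _ => (Measurable.of_discrete (f := V)).comp (hXm _)).const_mul _

omit [Fintype ι] [DecidableEq ι] [MeasurableSpace ι] [DiscreteMeasurableSpace ι] in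
theorem le_riemannSum {c : ℝ} (hc : ∀ i, c ≤ V i) (m n : ℕ) (x : ℝ≥0 → ι) :
    c * gridPt m n ≤ riemannSum V m x n := by
  have h1 : (n : ℝ) * c ≤ ∑ k ∈ Finset.range n, V (x (gridPt m (k + 1))) := by
    have := Finset.card_nsmul_le_sum (Finset.range n) (fun k => V (x (gridPt m (k + 1)))) c
      (fun k _ => hc _)
    simpa using this
  rw [riemannSum, gridPt]
  push_cast
  rw [div_eq_inv_mul, mul_left_comm, mul_comm c]
  exact mul_le_mul_of_nonneg_left h1 (by positivity)

include hX

theorem gridMass_zero (m : ℕ) (j : ι) : gridMass μ V X m 0 j = (1 : Matrix ι ι ℝ) a j := by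
  rw [← hX.measureReal_start, gridMass]
  simp only [riemannSum, Finset.range_zero, Finset.sum_empty, mul_zero, neg_zero, Real.exp_zero,
    one_mul, gridPt_zero]
  exact integral_indicator_one (hX.measurable 0 (MeasurableSet.singleton j))

/-- The Chapman–Kolmogorov equation of the killed chain on the grid. -/
theorem gridMass_succ (m n : ℕ) (j : ι) :
    gridMass μ V X m (n + 1) j = ∑ i, gridMass μ V X m n i * gridStep Q V m i j := by
  have key := hX.integral_mul_indicator (monotone_gridPt m) n
    (fun p => Real.exp (-(((m : ℝ) + 1)⁻¹ * ∑ k : Fin n, V (p k.succ)))) j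
  have hsum : ∀ ω, ∑ k : Fin n, V (X (gridPt m (k.succ : ℕ)) ω) =
      ∑ k ∈ Finset.range n, V (X (gridPt m (k + 1)) ω) := fun ω => by
    rw [Finset.sum_range]; simp
  simp only [hsum] at key
  change ∫ ω, Real.exp (-riemannSum V m (fun t => X t ω) n) * _ ∂μ =
    ∫ ω, Real.exp (-riemannSum V m (fun t => X t ω) n) * _ ∂μ at key
  have hδ : ((gridPt m (n + 1) : ℝ≥0) : ℝ) - gridPt m n = ((m : ℝ) + 1)⁻¹ := by
    rw [gridPt_succ]; push_cast; rw [one_div]; ring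
  rw [hδ] at key
  have h1 : gridMass μ V X m (n + 1) j = Real.exp (-((m : ℝ) + 1)⁻¹ * V j) *
      ∫ ω, Real.exp (-riemannSum V m (fun t => X t ω) n) *
        {ω | X (gridPt m (n + 1)) ω = j}.indicator 1 ω ∂μ := by
    rw [gridMass, ← integral_const_mul]
    congr 1
    funext ω
    by_cases h : X (gridPt m (n + 1)) ω = j
    · rw [Set.indicator_of_mem (show ω ∈ {ω | X (gridPt m (n + 1)) ω = j} from h),
        Pi.one_apply, mul_one, mul_one, ← Real.exp_add]
      congr 1
      simp only [riemannSum, Finset.sum_range_succ, h]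
      ring
    · rw [Set.indicator_of_notMem (show ω ∉ {ω | X (gridPt m (n + 1)) ω = j} from h)]
      simp
  rw [h1, key]
  have h2 : ∀ ω, Real.exp (-riemannSum V m (fun t => X t ω) n) *
      NormedSpace.exp (((m : ℝ) + 1)⁻¹ • Q) (X (gridPt m n) ω) j =
      ∑ i, (Real.exp (-riemannSum V m (fun t => X t ω) n) *
        {ω | X (gridPt m n) ω = i}.indicator 1 ω) *
          NormedSpace.exp (((m : ℝ) + 1)⁻¹ • Q) i j := by
    intro ω
    rw [Finset.sum_eq_single (X (gridPt m n) ω)]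
    · simp
    · intro i _ hi
      rw [Set.indicator_of_notMem (s := {ω | X (gridPt m n) ω = i}) (a := ω)
        (fun h => hi (Eq.symm h))]
      simp
    · simp
  simp only [h2]
  rw [integral_finsetSum, Finset.mul_sum]
  · refine Finset.sum_congr rfl fun i _ => ?_
    rw [integral_mul_const, gridStep, gridMass]
    ring
  · intro i _
    refine Integrable.mul_const ?_ _
    obtain ⟨c, hc⟩ : ∃ c, ∀ i, c ≤ V i := (Finite.bddBelow_range V).imp fun c hc i => hc ⟨i, rfl⟩
    refine Integrable.of_bound (C := Real.exp (-(c * gridPt m n))) ?_ (Eventually.of_forall ?_)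
    · exact ((Real.measurable_exp.comp (measurable_riemannSum hX.measurable V m n).neg).mul
        (measurable_one.indicator
          (hX.measurable _ (MeasurableSet.singleton i)))).aestronglyMeasurable
    · intro ω
      rw [norm_mul, Real.norm_of_nonneg (Real.exp_pos _).le]
      refine (mul_le_of_le_one_right (Real.exp_pos _).le
        ((norm_indicator_le_norm_self _ _).trans (by simp))).trans ?_
      exact Real.exp_le_exp.2 (neg_le_neg (le_riemannSum hc m n _))

omit hX [Fintype ι] [DecidableEq ι] [MeasurableSpace ι] [DiscreteMeasurableSpace ι] in
theorem abs_gridMass_le {c : ℝ} (hc : ∀ i, c ≤ V i) (m n : ℕ) (j : ι) :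
    |gridMass μ V X m n j| ≤ Real.exp (-(c * gridPt m n)) := by
  rw [← Real.norm_eq_abs, gridMass]
  refine (norm_integral_le_of_norm_le_const (C := Real.exp (-(c * gridPt m n)))
    (Eventually.of_forall fun ω => ?_)).trans (by simp)
  rw [norm_mul, Real.norm_of_nonneg (Real.exp_pos _).le]
  refine (mul_le_of_le_one_right (Real.exp_pos _).le
    ((norm_indicator_le_norm_self _ _).trans (by simp))).trans ?_
  exact Real.exp_le_exp.2 (neg_le_neg (le_riemannSum hc m n _))

end GridMarkov

section ExpDeriv

variable {ι : Type*} [Fintype ι] [DecidableEq ι]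

theorem hasDerivAt_exp_smul_apply (Q : Matrix ι ι ℝ) (i j : ι) :
    HasDerivAt (fun t : ℝ => NormedSpace.exp (t • Q) i j) (Q i j) 0 := by
  -- matrices carry no global norm; any normed algebra structure gives the same exponential
  let _ : NormedRing (Matrix ι ι ℝ) := Matrix.linftyOpNormedRing
  let _ : NormedAlgebra ℝ (Matrix ι ι ℝ) := Matrix.linftyOpNormedAlgebra
  have h := hasDerivAt_exp_smul_const (𝕂 := ℝ) Q 0
  rw [zero_smul, NormedSpace.exp_zero, one_mul] at h
  exact (hasDerivAt_pi.1 ((hasDerivAt_pi.1 h) i)) j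

theorem hasDerivAt_exp_smul_apply_mul_exp (Q : Matrix ι ι ℝ) (V : ι → ℝ) (i j : ι) :
    HasDerivAt (fun t : ℝ => NormedSpace.exp (t • Q) i j * Real.exp (-t * V j))
      (-(Matrix.diagonal V - Q) i j) 0 := by
  have h1 : HasDerivAt (fun t : ℝ => Real.exp (-t * V j)) (-V j) 0 := by
    have := ((hasDerivAt_id (0 : ℝ)).neg.mul_const (V j)).exp
    simpa using this
  have h2 := (hasDerivAt_exp_smul_apply Q i j).fun_mul h1
  refine h2.congr_deriv ?_
  by_cases hij : i = j
  · subst hij; simp; ring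
  · simp [hij]

/-- The killed chain on the grid has generator `Q - diag V` in the limit of fine grids. -/
theorem tendsto_gridStep (Q : Matrix ι ι ℝ) (V : ι → ℝ) (i j : ι) :
    Tendsto (fun m : ℕ => ((m : ℝ) + 1) * ((1 : Matrix ι ι ℝ) i j - gridStep Q V m i j)) atTop
      (𝓝 ((Matrix.diagonal V - Q) i j)) := by
  have h1 := (hasDerivAt_exp_smul_apply_mul_exp Q V i j).tendsto_slope_zero_right
  have h2 : Tendsto (fun m : ℕ => ((m : ℝ) + 1)⁻¹) atTop (𝓝[>] 0) := by
    refine tendsto_nhdsWithin_iff.2 ⟨?_, Eventually.of_forall fun m => ?_⟩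
    · simpa using tendsto_one_div_add_atTop_nhds_zero_nat (𝕜 := ℝ)
    · exact inv_pos.2 (by positivity : (0 : ℝ) < (m : ℝ) + 1)
  have h3 := (h1.comp h2).neg
  rw [neg_neg] at h3
  refine h3.congr fun m => ?_
  simp [gridStep]
  ring

theorem tendsto_gridStep_one (Q : Matrix ι ι ℝ) (V : ι → ℝ) (i j : ι) :
    Tendsto (fun m : ℕ => gridStep Q V m i j) atTop (𝓝 ((1 : Matrix ι ι ℝ) i j)) := by
  have h1 := (hasDerivAt_exp_smul_apply_mul_exp Q V i j).continuousAt.tendsto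
  have h2 : Tendsto (fun m : ℕ => ((m : ℝ) + 1)⁻¹) atTop (𝓝 0) := by
    simpa using tendsto_one_div_add_atTop_nhds_zero_nat (𝕜 := ℝ)
  have h3 := h1.comp h2
  simp only [zero_smul, NormedSpace.exp_zero, neg_zero, zero_mul, Real.exp_zero, mul_one] at h3
  exact h3

end ExpDeriv

/-! ### The Feynman–Kac formula for the resolvent -/

section FeynmanKac

variable {ι Ω : Type*} [Fintype ι] [DecidableEq ι] [MeasurableSpace ι] [DiscreteMeasurableSpace ι]
  [MeasurableSpace Ω]

omit [DecidableEq ι] [MeasurableSpace ι] [DiscreteMeasurableSpace ι] in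
theorem exists_abs_le (V : ι → ℝ) : ∃ M, 0 ≤ M ∧ ∀ i, |V i| ≤ M :=
  ⟨∑ i, |V i|, Finset.sum_nonneg fun _ _ => abs_nonneg _, fun i =>
    Finset.single_le_sum (f := fun i => |V i|) (fun _ _ => abs_nonneg _) (Finset.mem_univ i)⟩

omit [Fintype ι] [DecidableEq ι] [MeasurableSpace ι] [DiscreteMeasurableSpace ι] in
theorem measurable_comp_upGrid (V : ι → ℝ) (m : ℕ) (x : ℝ≥0 → ι) :
    Measurable fun v : ℝ => V (x (upGrid m v.toNNReal)) := by
  simp only [upGrid_eq]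
  exact (Measurable.of_discrete (f := fun k : ℕ => V (x (gridPt m k)))).comp
    ((measurable_gridIdx m).comp measurable_real_toNNReal)

omit [DecidableEq ι] [MeasurableSpace ι] [DiscreteMeasurableSpace ι] in
theorem intervalIntegrable_comp_upGrid (V : ι → ℝ) (m : ℕ) (x : ℝ≥0 → ι) (s t : ℝ) :
    IntervalIntegrable (fun v : ℝ => V (x (upGrid m v.toNNReal))) volume s t := by
  obtain ⟨M, hM0, hM⟩ := exists_abs_le V
  refine (intervalIntegrable_const (c := M)).mono_fun
    (measurable_comp_upGrid V m x).aestronglyMeasurable (Eventually.of_forall fun v => ?_)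
  simp only [Real.norm_eq_abs, abs_of_nonneg hM0]
  exact hM _

omit [DecidableEq ι] [MeasurableSpace ι] [DiscreteMeasurableSpace ι] in
theorem riemannSum_eq_integral (V : ι → ℝ) (m : ℕ) (x : ℝ≥0 → ι) (n : ℕ) :
    riemannSum V m x n = ∫ v in (0 : ℝ)..gridPt m n, V (x (upGrid m v.toNNReal)) := by
  have h := intervalIntegral.sum_integral_adjacent_intervals (μ := volume)
    (f := fun v : ℝ => V (x (upGrid m v.toNNReal))) (a := fun k => (gridPt m k : ℝ)) (n := n)
    (fun k _ => intervalIntegrable_comp_upGrid V m x _ _)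
  simp only [gridPt_zero, NNReal.coe_zero] at h
  rw [← h, riemannSum, Finset.mul_sum]
  refine Finset.sum_congr rfl fun k _ => ?_
  have hle : (gridPt m k : ℝ) ≤ gridPt m (k + 1) := by
    exact_mod_cast monotone_gridPt m (Nat.le_succ k)
  have h2 : ∫ v in (gridPt m k : ℝ)..gridPt m (k + 1), V (x (upGrid m v.toNNReal)) =
      ∫ _v in (gridPt m k : ℝ)..gridPt m (k + 1), V (x (gridPt m (k + 1))) := by
    refine intervalIntegral.integral_congr_Ioo_of_le hle fun v hv => ?_
    have hv0 : 0 ≤ v := (gridPt m k).2.trans hv.1.le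
    simp only [upGrid_eq]
    rw [gridIdx_eq (k := k)]
    · rw [Real.le_toNNReal_iff_coe_le hv0]; exact hv.1.le
    · rw [Real.toNNReal_lt_iff_lt_coe hv0]; exact hv.2
  rw [h2, intervalIntegral.integral_const, gridPt_succ, smul_eq_mul]
  push_cast
  rw [one_div]
  ring

omit [DecidableEq ι] [MeasurableSpace ι] [DiscreteMeasurableSpace ι] in
/-- The right endpoint Riemann sums converge because right-continuous step functions are limits of
their values along the grid. -/
theorem tendsto_riemannSum (V : ι → ℝ) {x : ℝ≥0 → ι} (hx : ∀ t, ∀ᶠ s in 𝓝[≥] t, x s = x t)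
    (s : ℝ≥0) : Tendsto (fun m => riemannSum V m x (gridIdx m s)) atTop
      (𝓝 (∫ v in (0 : ℝ)..s, V (x v.toNNReal))) := by
  obtain ⟨M, hM0, hM⟩ := exists_abs_le V
  have hup : Tendsto (fun m => (upGrid m s : ℝ)) atTop (𝓝 s) :=
    NNReal.tendsto_coe.2 ((tendsto_upGrid s).mono_right nhdsWithin_le_nhds)
  have h1 : Tendsto (fun m => ∫ v in (0 : ℝ)..s, V (x (upGrid m v.toNNReal))) atTop
      (𝓝 (∫ v in (0 : ℝ)..s, V (x v.toNNReal))) := by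
    refine intervalIntegral.tendsto_integral_filter_of_dominated_convergence (fun _ => M)
      (Eventually.of_forall fun m => (measurable_comp_upGrid V m x).aestronglyMeasurable)
      (Eventually.of_forall fun m => Eventually.of_forall fun v _ => ?_)
      intervalIntegrable_const (Eventually.of_forall fun v _ => ?_)
    · exact hM _
    · refine tendsto_const_nhds.congr' ?_
      filter_upwards [(tendsto_upGrid v.toNNReal).eventually (hx v.toNNReal)] with m hm
      rw [hm]
  have h2 : Tendsto (fun m => ∫ v in (s : ℝ)..upGrid m s, V (x (upGrid m v.toNNReal))) atTop
      (𝓝 0) := by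
    refine squeeze_zero_norm (a := fun m => M * |(upGrid m s : ℝ) - s|) (fun m => ?_) ?_
    · exact intervalIntegral.norm_integral_le_of_norm_le_const fun v _ => hM _
    · have := ((hup.sub_const (s : ℝ)).abs).const_mul M
      simpa using this
  have h3 := h1.add h2
  rw [add_zero] at h3
  refine h3.congr fun m => ?_
  rw [riemannSum_eq_integral, ← upGrid_eq]
  exact intervalIntegral.integral_add_adjacent_intervals
    (intervalIntegrable_comp_upGrid V m x _ _) (intervalIntegrable_comp_upGrid V m x _ _)

/-- The Feynman–Kac functional `E[1{X_s = j} exp (-∫_0^s V(X_v) dv)]`. -/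
def feynmanKac (μ : Measure Ω) (V : ι → ℝ) (X : ℝ≥0 → Ω → ι) (s : ℝ≥0) (j : ι) : ℝ :=
  ∫ ω, Real.exp (-∫ v in (0 : ℝ)..s, V (X v.toNNReal ω)) * {ω | X s ω = j}.indicator 1 ω ∂μ

variable {μ : Measure Ω} [IsProbabilityMeasure μ] {Q : Matrix ι ι ℝ} {a : ι} {X : ℝ≥0 → Ω → ι}
  (hX : IsMarkovChain μ Q a X) {V : ι → ℝ} {c : ℝ} (hc0 : 0 < c) (hc : ∀ i, c ≤ V i)

omit [Fintype ι] [DecidableEq ι] [MeasurableSpace ι] [DiscreteMeasurableSpace ι] in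
include hc0 hc in
theorem abs_gridMass_gridIdx_le (m : ℕ) (s : ℝ) (j : ι) :
    |gridMass μ V X m (gridIdx m s.toNNReal) j| ≤ Real.exp (-c * s) := by
  refine (abs_gridMass_le hc m _ j).trans (Real.exp_le_exp.2 ?_)
  rw [← upGrid_eq]
  have h1 : s ≤ upGrid m s.toNNReal :=
    (Real.le_coe_toNNReal s).trans (by exact_mod_cast le_upGrid m s.toNNReal)
  nlinarith

omit [Fintype ι] [DecidableEq ι] [MeasurableSpace ι] [DiscreteMeasurableSpace ι]
  [IsProbabilityMeasure μ] in
theorem measurable_gridMass_gridIdx (m : ℕ) (j : ι) :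
    Measurable fun s : ℝ => gridMass μ V X m (gridIdx m s.toNNReal) j :=
  (Measurable.of_discrete (f := fun n : ℕ => gridMass μ V X m n j)).comp
    ((measurable_gridIdx m).comp measurable_real_toNNReal)

omit [Fintype ι] [DecidableEq ι] [MeasurableSpace ι] [DiscreteMeasurableSpace ι] in
include hc0 hc in
theorem integrableOn_gridMass_gridIdx (m : ℕ) (j : ι) :
    IntegrableOn (fun s : ℝ => gridMass μ V X m (gridIdx m s.toNNReal) j) (Set.Ioi 0) :=
  (exp_neg_integrableOn_Ioi 0 hc0).mono' (measurable_gridMass_gridIdx m j).aestronglyMeasurable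
    (Eventually.of_forall fun s => abs_gridMass_gridIdx_le hc0 hc m s j)

include hX hc0 hc

theorem tendsto_gridMass (s : ℝ≥0) (j : ι) :
    Tendsto (fun m => gridMass μ V X m (gridIdx m s) j) atTop (𝓝 (feynmanKac μ V X s j)) := by
  refine tendsto_integral_of_dominated_convergence (fun _ => 1) ?_ (integrable_const 1) ?_ ?_
  · intro m
    exact ((Real.measurable_exp.comp (measurable_riemannSum hX.measurable V m _).neg).mul
      (measurable_one.indicator (hX.measurable _ (MeasurableSet.singleton j)))).aestronglyMeasurable
  · intro m
    refine Eventually.of_forall fun ω => ?_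
    rw [norm_mul, Real.norm_of_nonneg (Real.exp_pos _).le]
    refine (mul_le_of_le_one_right (Real.exp_pos _).le
      ((norm_indicator_le_norm_self _ _).trans (by simp))).trans ?_
    rw [Real.exp_le_one_iff, neg_nonpos]
    exact (mul_nonneg hc0.le (NNReal.coe_nonneg _)).trans (le_riemannSum hc m _ _)
  · refine Eventually.of_forall fun ω => Tendsto.mul ?_ ?_
    · exact (Real.continuous_exp.tendsto _).comp
        (tendsto_riemannSum V (hX.rightContinuous ω) s).neg
    · refine tendsto_const_nhds.congr' ?_
      filter_upwards [(tendsto_upGrid s).eventually (hX.rightContinuous ω s)] with m hm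
      rw [upGrid_eq] at hm
      simp only [Set.indicator_apply, Set.mem_ofPred_eq, hm]

theorem tendsto_integral_gridMass (j : ι) :
    Tendsto (fun m => ∫ s in Set.Ioi (0 : ℝ), gridMass μ V X m (gridIdx m s.toNNReal) j) atTop
      (𝓝 (∫ s in Set.Ioi (0 : ℝ), feynmanKac μ V X s.toNNReal j)) :=
  tendsto_integral_of_dominated_convergence (fun s => Real.exp (-c * s))
    (fun m => (measurable_gridMass_gridIdx m j).aestronglyMeasurable)
    (exp_neg_integrableOn_Ioi 0 hc0)
    (fun m => Eventually.of_forall fun s => abs_gridMass_gridIdx_le hc0 hc m s j)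
    (Eventually.of_forall fun s => tendsto_gridMass hX hc0 hc s.toNNReal j)

/-- The resolvent equation on the grid. The one-step equation reads `U (s + δ) = U s * gridStep`
with `δ = 1 / (m + 1)`; integrating it over `s > 0` leaves the contribution of `(0, δ]`, which is
one step from `a`. -/
theorem sum_integral_gridMass_mul (m : ℕ) (j : ι) :
    ∑ i, (∫ s in Set.Ioi (0 : ℝ), gridMass μ V X m (gridIdx m s.toNNReal) i) *
      (((m : ℝ) + 1) * ((1 : Matrix ι ι ℝ) i j - gridStep Q V m i j)) = gridStep Q V m a j := by
  have hδ : (0 : ℝ) < ((m : ℝ) + 1)⁻¹ := by positivity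
  set δ : ℝ := ((m : ℝ) + 1)⁻¹ with hδ'
  set U : ι → ℝ → ℝ := fun i s => gridMass μ V X m (gridIdx m s.toNNReal) i with hU
  have hUi : ∀ i, IntegrableOn (U i) (Set.Ioi 0) := fun i =>
    integrableOn_gridMass_gridIdx hc0 hc m i
  have hshift : ∀ s ∈ Set.Ioi (0 : ℝ), U j (s + δ) = ∑ i, U i s * gridStep Q V m i j := by
    intro s hs
    have h1 : (s + δ).toNNReal = s.toNNReal + 1 / ((m : ℝ≥0) + 1) := by
      rw [Real.toNNReal_add (le_of_lt hs) hδ.le]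
      congr 1
      ext
      rw [Real.coe_toNNReal _ hδ.le]
      push_cast
      rw [one_div]
    simp only [hU, h1, gridIdx_add]
    exact gridMass_succ hX m _ j
  have h2 : ∫ s in Set.Ioi (0 : ℝ), U j (s + δ) =
      ∑ i, (∫ s in Set.Ioi (0 : ℝ), U i s) * gridStep Q V m i j := by
    rw [setIntegral_congr_fun measurableSet_Ioi hshift,
      integral_finsetSum _ fun i _ => (hUi i).mul_const _]
    simp only [integral_mul_const]
  have h3 : ∫ s in Set.Ioi (0 : ℝ), U j (s + δ) = ∫ s in Set.Ioi δ, U j s := by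
    have h5 := (measurePreserving_add_right volume δ).setIntegral_preimage_emb
      (measurableEmbedding_addRight δ) (U j) (Set.Ioi δ)
    rwa [Set.preimage_add_const_Ioi, sub_self] at h5
  have h4 : ∫ s in Set.Ioc (0 : ℝ) δ, U j s = δ * gridStep Q V m a j := by
    rw [integral_Ioc_eq_integral_Ioo]
    have : ∀ s ∈ Set.Ioo (0 : ℝ) δ, U j s = gridStep Q V m a j := by
      intro s hs
      have h5 : gridIdx m s.toNNReal = 0 + 1 := by
        refine gridIdx_eq (by simp [gridPt_zero]) ?_
        rw [gridPt_succ, gridPt_zero, zero_add, Real.toNNReal_lt_iff_lt_coe hs.1.le]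
        push_cast
        rw [one_div]
        exact hs.2
      simp only [hU, h5]
      rw [gridMass_succ hX m 0 j]
      simp only [gridMass_zero hX]
      simp [Matrix.one_apply]
    rw [setIntegral_congr_fun measurableSet_Ioo this]
    simp [hδ.le]
  have h6 : ∫ s in Set.Ioi (0 : ℝ), U j s =
      (∫ s in Set.Ioc (0 : ℝ) δ, U j s) + ∫ s in Set.Ioi δ, U j s := by
    rw [← setIntegral_union Set.Ioc_disjoint_Ioi_same measurableSet_Ioi
      ((hUi j).mono_set Set.Ioc_subset_Ioi_self)
      ((hUi j).mono_set (Set.Ioi_subset_Ioi hδ.le)), Set.Ioc_union_Ioi_eq_Ioi hδ.le]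
  rw [h4, ← h3, h2] at h6
  have h7 : ∑ i, (∫ s in Set.Ioi (0 : ℝ), U i s) *
      (((m : ℝ) + 1) * ((1 : Matrix ι ι ℝ) i j - gridStep Q V m i j)) =
      ((m : ℝ) + 1) * ((∫ s in Set.Ioi (0 : ℝ), U j s) -
        ∑ i, (∫ s in Set.Ioi (0 : ℝ), U i s) * gridStep Q V m i j) := by
    have h8 : ∫ s in Set.Ioi (0 : ℝ), U j s =
        ∑ i, (∫ s in Set.Ioi (0 : ℝ), U i s) * (1 : Matrix ι ι ℝ) i j := by
      simp [Matrix.one_apply]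
    rw [h8, ← Finset.sum_sub_distrib, Finset.mul_sum]
    exact Finset.sum_congr rfl fun i _ => by ring
  rw [h7, h6, hδ']
  field_simp
  ring

/-- The Feynman–Kac formula for the resolvent: the potential measure of the killed chain started
at `a` is the row `a` of `(diag V - Q)⁻¹`. -/
theorem vecMul_integral_feynmanKac :
    Matrix.vecMul (fun i => ∫ s in Set.Ioi (0 : ℝ), feynmanKac μ V X s.toNNReal i)
      (Matrix.diagonal V - Q) = Pi.single a 1 := by
  funext j
  have h1 : Tendsto (fun m => ∑ i,
      (∫ s in Set.Ioi (0 : ℝ), gridMass μ V X m (gridIdx m s.toNNReal) i) *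
        (((m : ℝ) + 1) * ((1 : Matrix ι ι ℝ) i j - gridStep Q V m i j))) atTop
      (𝓝 (∑ i, (∫ s in Set.Ioi (0 : ℝ), feynmanKac μ V X s.toNNReal i) *
        (Matrix.diagonal V - Q) i j)) :=
    tendsto_finsetSum _ fun i _ =>
      (tendsto_integral_gridMass hX hc0 hc i).mul (tendsto_gridStep Q V i j)
  simp only [sum_integral_gridMass_mul hX hc0 hc] at h1
  have h2 := tendsto_nhds_unique h1 (tendsto_gridStep_one Q V a j)
  rw [Matrix.one_eq_pi_single] at h2
  rw [← h2]
  rfl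

end FeynmanKac

/-! ### Inversion of one-dimensional Laplace transforms -/

section RealFunctions

/-- Uniqueness for Laplace transforms of functions, in the case of an exponential. -/
theorem ae_eq_exp_of_integral_exp_mul {f : ℝ → ℝ} (hf : Measurable f) (hf0 : ∀ r, 0 ≤ f r)
    (hf1 : ∀ r, f r ≤ 1) {ψ : ℝ} (hψ : 0 ≤ ψ)
    (h : ∀ θ > 0, ∫ r in Set.Ioi (0 : ℝ), Real.exp (-θ * r) * f r = (ψ + θ)⁻¹) :
    ∀ᵐ r ∂(volume.restrict (Set.Ioi (0 : ℝ))), f r = Real.exp (-ψ * r) := by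
  set ν : Measure ℝ := volume.restrict (Set.Ioi (0 : ℝ)) with hν
  -- the weight `exp (-r)` makes both densities integrable, so that finite measures are compared
  have hi1 : Integrable (fun r => Real.exp (-1 * r) * f r) ν := by
    refine (exp_neg_integrableOn_Ioi 0 one_pos).mono'
      ((by fun_prop : Measurable fun r : ℝ => Real.exp (-1 * r)).mul hf).aestronglyMeasurable
      (Eventually.of_forall fun r => ?_)
    rw [Real.norm_of_nonneg (mul_nonneg (Real.exp_pos _).le (hf0 r))]
    exact mul_le_of_le_one_right (Real.exp_pos _).le (hf1 r)
  have hi2 : Integrable (fun r => Real.exp (-1 * r) * Real.exp (-ψ * r)) ν := by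
    have := exp_neg_integrableOn_Ioi 0 (by linarith : 0 < 1 + ψ)
    refine this.congr (Eventually.of_forall fun r => ?_)
    simp only [← Real.exp_add]
    congr 1; ring
  have hm1 : Measurable (fun r => Real.exp (-1 * r) * f r) :=
    (by fun_prop : Measurable fun r : ℝ => Real.exp (-1 * r)).mul hf
  have hm2 : Measurable (fun r => Real.exp (-1 * r) * Real.exp (-ψ * r)) := by fun_prop
  have hn1 : ∀ r, 0 ≤ Real.exp (-1 * r) * f r := fun r => mul_nonneg (Real.exp_pos _).le (hf0 r)
  have hn2 : ∀ r, 0 ≤ Real.exp (-1 * r) * Real.exp (-ψ * r) := fun r => by positivity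
  have hfin1 : ∫⁻ r, ENNReal.ofReal (Real.exp (-1 * r) * f r) ∂ν ≠ ⊤ :=
    (hasFiniteIntegral_iff_ofReal (Eventually.of_forall hn1)).1 hi1.2 |>.ne
  have hfin2 : ∫⁻ r, ENNReal.ofReal (Real.exp (-1 * r) * Real.exp (-ψ * r)) ∂ν ≠ ⊤ :=
    (hasFiniteIntegral_iff_ofReal (Eventually.of_forall hn2)).1 hi2.2 |>.ne
  have := isFiniteMeasure_withDensity hfin1
  have := isFiniteMeasure_withDensity hfin2
  have hsupp : ∀ᵐ r ∂ν, r ∈ Set.Ici (0 : ℝ) :=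
    (ae_restrict_mem measurableSet_Ioi).mono fun r hr => le_of_lt (Set.mem_Ioi.1 hr)
  have key : ν.withDensity (fun r => ENNReal.ofReal (Real.exp (-1 * r) * f r)) =
      ν.withDensity fun r => ENNReal.ofReal (Real.exp (-1 * r) * Real.exp (-ψ * r)) := by
    refine ext_of_forall_integral_exp_neg (κ := Unit) (φ := fun _ (r : ℝ) => r)
      (fun _ => continuous_id) (C := Set.Ici 0) isClosed_Ici (fun _ r hr => hr)
      (fun r _ s _ hrs => hrs ()) _ _ ((withDensity_absolutelyContinuous _ _).ae_le hsupp)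
      ((withDensity_absolutelyContinuous _ _).ae_le hsupp) fun n => ?_
    rw [integral_withDensity_eq_integral_toReal_smul hm1.ennreal_ofReal
        (Eventually.of_forall fun _ => ENNReal.ofReal_lt_top),
      integral_withDensity_eq_integral_toReal_smul hm2.ennreal_ofReal
        (Eventually.of_forall fun _ => ENNReal.ofReal_lt_top)]
    simp only [ENNReal.toReal_ofReal (hn1 _), ENNReal.toReal_ofReal (hn2 _), smul_eq_mul,
      Finset.univ_unique, Finset.sum_singleton]
    have hθ : (0 : ℝ) < n () + 1 := by positivity
    have e1 := h _ hθ
    have e2 : ∫ r in Set.Ioi (0 : ℝ), Real.exp (-(ψ + (n () + 1)) * r) =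
        (ψ + (n () + 1))⁻¹ := by
      rw [integral_exp_mul_Ioi (by linarith) 0, mul_zero, Real.exp_zero, neg_div_neg_eq, one_div]
    trans (ψ + (n () + 1))⁻¹
    · rw [← e1]
      congr 1; funext r
      rw [mul_right_comm, ← Real.exp_add]
      congr 2
      change -1 * r + -((n () : ℝ) * r) = _
      ring
    · rw [← e2]
      congr 1; funext r
      rw [← Real.exp_add, ← Real.exp_add]
      congr 1
      change _ = -1 * r + -ψ * r + -((n () : ℝ) * r)
      ring
  have h3 := (withDensity_eq_iff hm1.ennreal_ofReal.aemeasurable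
    hm2.ennreal_ofReal.aemeasurable hfin1).1 key
  filter_upwards [h3] with r hr
  have h4 := (ENNReal.ofReal_eq_ofReal_iff (hn1 r) (hn2 r)).1 hr
  exact mul_left_cancel₀ (Real.exp_pos _).ne' h4

/-- A monotone function which is almost everywhere equal to a continuous one is equal to it. -/
theorem eq_of_antitoneOn_of_ae_eq {f g : ℝ → ℝ} (hf : AntitoneOn f (Set.Ioi 0))
    (hg : Continuous g) (hfg : ∀ᵐ r ∂(volume.restrict (Set.Ioi (0 : ℝ))), f r = g r) {r : ℝ}
    (hr : 0 < r) : f r = g r := by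
  have hex : ∀ s t : ℝ, 0 ≤ s → s < t → ∃ u ∈ Set.Ioo s t, f u = g u := by
    intro s t hs hst
    by_contra hcon
    push Not at hcon
    have h1 : ∀ᵐ u ∂(volume : Measure ℝ), u ∉ Set.Ioo s t := by
      have h2 := (ae_restrict_iff' measurableSet_Ioi).1 hfg
      filter_upwards [h2] with u hu hust
      exact hcon u hust (hu (hs.trans_lt hust.1))
    have h2 : volume (Set.Ioo s t) = 0 := by
      rw [measure_eq_zero_iff_ae_notMem]; exact h1
    rw [Real.volume_Ioo, ENNReal.ofReal_eq_zero] at h2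
    linarith
  refine le_antisymm (le_of_forall_pos_le_add fun ε hε => ?_)
    (le_of_forall_pos_le_add fun ε hε => ?_)
  · obtain ⟨δ, hδ, hδ'⟩ := Metric.continuousAt_iff.1 (hg.continuousAt (x := r)) ε hε
    obtain ⟨u, hu, hfu⟩ := hex (max 0 (r - δ)) r (le_max_left _ _) (max_lt hr (by linarith))
    have hu0 : 0 < u := (le_max_left _ _).trans_lt hu.1
    have h1 := hf hu0 hr hu.2.le
    have h2 := hδ' (x := u) (by
      rw [Real.dist_eq, abs_lt]
      have := (le_max_right 0 (r - δ)).trans_lt hu.1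
      constructor <;> linarith [hu.2])
    rw [Real.dist_eq, abs_lt] at h2
    linarith [h2.2]
  · obtain ⟨δ, hδ, hδ'⟩ := Metric.continuousAt_iff.1 (hg.continuousAt (x := r)) ε hε
    obtain ⟨u, hu, hfu⟩ := hex r (r + δ) hr.le (by linarith)
    have h1 := hf hr (hr.trans hu.1) hu.1.le
    have h2 := hδ' (x := u) (by
      rw [Real.dist_eq, abs_lt]
      constructor <;> linarith [hu.1, hu.2])
    rw [Real.dist_eq, abs_lt] at h2
    linarith [h2.1]

end RealFunctions

/-! ### Law of the local times at the inverse local time -/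

section InverseLocalTime

variable {ι Ω : Type*} [Fintype ι] [DecidableEq ι] [MeasurableSpace ι] [DiscreteMeasurableSpace ι]
  [MeasurableSpace Ω] {μ : Measure Ω} [IsProbabilityMeasure μ] {P : Matrix ι ι ℝ} {π : ι → ℝ}
  {a : ι} {X : ℝ≥0 → Ω → ι}

/-- `exp (-⟨lam, L⟩)` at the inverse local time `r` at `a`, on the event that the total local time
at `a` reaches `r`, and `0` off it. The event has full measure (`ae_exists_le_localTime`), but
that is a consequence of computing the expectation of this weight. -/
def reachWeight (a : ι) (lam : ι → ℝ) (X : ℝ≥0 → Ω → ι) (p : ℝ × Ω) : ℝ :=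
  {r | ∃ n : ℕ, r ≤ localTime (fun t => X t p.2) n a}.indicator
    (expLocalTimeInv (fun t => X t p.2) a lam) p.1

omit [MeasurableSpace ι] [DiscreteMeasurableSpace ι] [MeasurableSpace Ω] in
theorem reachWeight_of_exists {lam : ι → ℝ} {p : ℝ × Ω}
    (h : ∃ n : ℕ, p.1 ≤ localTime (fun t => X t p.2) n a) :
    reachWeight a lam X p = expLocalTimeInv (fun t => X t p.2) a lam p.1 :=
  Set.indicator_of_mem (s := {r | ∃ n : ℕ, r ≤ localTime (fun t => X t p.2) n a}) h _

omit [MeasurableSpace ι] [DiscreteMeasurableSpace ι] [MeasurableSpace Ω] in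
theorem reachWeight_of_not_exists {lam : ι → ℝ} {p : ℝ × Ω}
    (h : ¬∃ n : ℕ, p.1 ≤ localTime (fun t => X t p.2) n a) : reachWeight a lam X p = 0 :=
  Set.indicator_of_notMem (s := {r | ∃ n : ℕ, r ≤ localTime (fun t => X t p.2) n a}) h _

omit [MeasurableSpace ι] [DiscreteMeasurableSpace ι] [MeasurableSpace Ω] in
theorem reachWeight_nonneg (a : ι) (lam : ι → ℝ) (p : ℝ × Ω) : 0 ≤ reachWeight a lam X p :=
  Set.indicator_nonneg (fun _ _ => (expLocalTimeInv_pos a lam _).le) _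

section Measurability

variable (hXm : ∀ t, Measurable (X t)) (hrc : ∀ ω t, ∀ᶠ s in 𝓝[≥] t, X s ω = X t ω)

include hXm hrc

theorem measurableSet_reach (a : ι) :
    MeasurableSet {p : ℝ × Ω | ∃ n : ℕ, p.1 ≤ localTime (fun t => X t p.2) n a} := by
  have : {p : ℝ × Ω | ∃ n : ℕ, p.1 ≤ localTime (fun t => X t p.2) n a} =
      ⋃ n : ℕ, {p : ℝ × Ω | p.1 ≤ localTime (fun t => X t p.2) n a} := by
    ext p; simp
  rw [this]
  exact MeasurableSet.iUnion fun n => measurableSet_le measurable_fst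
    ((measurable_localTime hXm hrc a).comp (measurable_const.prodMk measurable_snd))

theorem measurable_reachWeight (a : ι) (lam : ι → ℝ) : Measurable (reachWeight a lam X) :=
  (measurable_expLocalTimeInv hXm hrc a lam).indicator (measurableSet_reach hXm hrc a)

theorem measurable_occWeight_uncurry (a : ι) (lam : ι → ℝ) (θ : ℝ) :
    Measurable fun p : ℝ × Ω => occWeight (fun t => X t p.2) a lam θ p.1 := by
  have hL : ∀ i, Measurable fun p : ℝ × Ω => localTime (fun t => X t p.2) p.1.toNNReal i :=
    fun i => (measurable_localTime hXm hrc i).comp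
      ((measurable_real_toNNReal.comp measurable_fst).prodMk measurable_snd)
  have hocc : Measurable fun p : ℝ × Ω => occ (fun t => X t p.2) a p.1 := by
    refine Measurable.ite ?_ measurable_const measurable_const
    exact ((measurable_uncurry_of_rightContinuous hXm hrc).comp
      ((measurable_real_toNNReal.comp measurable_fst).prodMk measurable_snd))
      (MeasurableSet.singleton a)
  exact hocc.mul (Real.measurable_exp.comp (((hL a).const_mul _).sub
    (Finset.measurable_sum _ fun i _ => (hL i).const_mul _)))

omit hXm [MeasurableSpace Ω] in
theorem reachWeight_le_one (a : ι) {lam : ι → ℝ} (hlam : 0 ≤ lam) (p : ℝ × Ω) :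
    reachWeight a lam X p ≤ 1 :=
  Set.indicator_apply_le' (fun _ => expLocalTimeInv_le_one (hrc p.2) a hlam _)
    fun _ => zero_le_one

theorem integrable_exp_mul_reachWeight (a : ι) {lam : ι → ℝ} (hlam : 0 ≤ lam) {θ : ℝ}
    (hθ : 0 < θ) : Integrable (fun p : ℝ × Ω => Real.exp (-θ * p.1) * reachWeight a lam X p)
      ((volume.restrict (Set.Ioi 0)).prod μ) := by
  have h1 : Integrable (fun p : ℝ × Ω => Real.exp (-θ * p.1) * (1 : ℝ))
      ((volume.restrict (Set.Ioi 0)).prod μ) :=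
    (exp_neg_integrableOn_Ioi 0 hθ).mul_prod (integrable_const 1)
  refine h1.mono' ?_ (Eventually.of_forall fun p => ?_)
  · exact ((by fun_prop : Measurable fun p : ℝ × Ω => Real.exp (-θ * p.1)).mul
      (measurable_reachWeight hXm hrc a lam)).aestronglyMeasurable
  · rw [Real.norm_of_nonneg (mul_nonneg (Real.exp_pos _).le (reachWeight_nonneg a lam p))]
    exact mul_le_mul_of_nonneg_left (reachWeight_le_one hrc a hlam p) (Real.exp_pos _).le

end Measurability

variable (hP : IsIrreducibleChain P π) (hX : IsMarkovChain μ (laplacian P π) a X)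

include hP hX

/-- The Laplace transform, in the level `r`, of the expected weight at the inverse local time `r`:
time change followed by the Feynman–Kac formula with potential `lam + θ 1_a`. Strict positivity of
`lam` makes the potential integrable in time. -/
theorem integral_exp_mul_reachWeight_of_pos {lam : ι → ℝ} {c : ℝ} (hc0 : 0 < c)
    (hc : ∀ i, c ≤ lam i) {θ : ℝ} (hθ : 0 < θ) :
    ∫ r in Set.Ioi (0 : ℝ), Real.exp (-θ * r) * ∫ ω, reachWeight a lam X (r, ω) ∂μ =
      (lapExponent (laplacian P π) a lam + θ)⁻¹ := by
  have hlam : 0 ≤ lam := fun i => hc0.le.trans (hc i)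
  have hrc := hX.rightContinuous
  set V : ι → ℝ := lam + Pi.single a θ with hV
  have hcV : ∀ i, c ≤ V i := fun i => by
    have : 0 ≤ (Pi.single a θ : ι → ℝ) i :=
      (Pi.single_nonneg.2 hθ.le : 0 ≤ (Pi.single a θ : ι → ℝ)) i
    simp only [hV, Pi.add_apply]; linarith [hc i]
  have h1 := hP.apply_eq_inv_lapExponent a (fun i => hc0.trans_le (hcV i)) _
    (vecMul_integral_feynmanKac hX hc0 hcV)
  rw [hV, hP.lapExponent_add_single a (fun i => hlam i)] at h1
  rw [← h1]
  have h2 : ∀ s ∈ Set.Ioi (0 : ℝ), feynmanKac μ V X s.toNNReal a =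
      ∫ ω, occWeight (fun t => X t ω) a lam θ s ∂μ := by
    intro s hs
    rw [feynmanKac]
    congr 1
    funext ω
    rw [occWeight, ← sum_mul_localTime_eq (hrc ω), mul_comm]
    have h3 : ∑ i, V i * localTime (fun t => X t ω) s.toNNReal i =
        ∑ i, lam i * localTime (fun t => X t ω) s.toNNReal i +
          θ * localTime (fun t => X t ω) s.toNNReal a := by
      simp only [hV, Pi.add_apply, add_mul, Finset.sum_add_distrib]
      congr 1
      simp [Pi.single_apply]
    rw [h3]
    congr 1
    · simp [occ, Set.indicator_apply]
    · congr 1; ring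
  rw [← hV, setIntegral_congr_fun measurableSet_Ioi h2]
  have hi : Integrable (fun p : ℝ × Ω => occWeight (fun t => X t p.2) a lam θ p.1)
      ((volume.restrict (Set.Ioi 0)).prod μ) := by
    have h4 : Integrable (fun p : ℝ × Ω => Real.exp (-c * p.1) * (1 : ℝ))
        ((volume.restrict (Set.Ioi 0)).prod μ) :=
      (exp_neg_integrableOn_Ioi 0 hc0).mul_prod (integrable_const 1)
    refine h4.mono' (measurable_occWeight_uncurry hX.measurable hrc a lam θ).aestronglyMeasurable
      (Eventually.of_forall fun p => ?_)
    rw [mul_one]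
    exact norm_occWeight_le (hrc p.2) a hc0.le hc hθ.le p.1
  rw [integral_integral_swap hi]
  simp only [← integral_const_mul]
  rw [integral_integral_swap (integrable_exp_mul_reachWeight hX.measurable hrc a hlam hθ)]
  congr 1
  funext ω
  rw [← integral_indicator_expLocalTimeInv (hrc ω) a hc0 hc hθ]
  congr 1
  funext r
  by_cases h : ∃ n : ℕ, r ≤ localTime (fun t => X t ω) n a
  · rw [reachWeight_of_exists (p := (r, ω)) h,
      Set.indicator_of_mem (s := {r | ∃ n : ℕ, r ≤ localTime (fun t => X t ω) n a}) h]
  · rw [reachWeight_of_not_exists (p := (r, ω)) h,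
      Set.indicator_of_notMem (s := {r | ∃ n : ℕ, r ≤ localTime (fun t => X t ω) n a}) h, mul_zero]

theorem integral_exp_mul_reachWeight {lam : ι → ℝ} (hlam : 0 ≤ lam) {θ : ℝ} (hθ : 0 < θ) :
    ∫ r in Set.Ioi (0 : ℝ), Real.exp (-θ * r) * ∫ ω, reachWeight a lam X (r, ω) ∂μ =
      (lapExponent (laplacian P π) a lam + θ)⁻¹ := by
  have hrc := hX.rightContinuous
  set lamn : ℕ → ι → ℝ := fun n i => lam i + 1 / ((n : ℝ) + 1) with hlamn
  have hpos : ∀ n : ℕ, (0 : ℝ) < 1 / ((n : ℝ) + 1) := fun n => by positivity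
  have hlamn0 : ∀ n, 0 ≤ lamn n := fun n i => add_nonneg (hlam i) (hpos n).le
  have hlim : Tendsto lamn atTop (𝓝 lam) := by
    refine tendsto_pi_nhds.2 fun i => ?_
    have := (tendsto_one_div_add_atTop_nhds_zero_nat (𝕜 := ℝ)).const_add (lam i)
    rwa [add_zero] at this
  have hR : Tendsto (fun n => (lapExponent (laplacian P π) a (lamn n) + θ)⁻¹) atTop
      (𝓝 (lapExponent (laplacian P π) a lam + θ)⁻¹) := by
    refine Tendsto.inv₀ ?_ (by have := hP.lapExponent_nonneg a (fun i => hlam i); positivity)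
    exact ((hP.continuousAt_lapExponent a (fun i => hlam i)).tendsto.comp hlim).add_const θ
  refine tendsto_nhds_unique ?_ hR
  have heq : ∀ n, (lapExponent (laplacian P π) a (lamn n) + θ)⁻¹ =
      ∫ p : ℝ × Ω, Real.exp (-θ * p.1) * reachWeight a (lamn n) X p
        ∂((volume.restrict (Set.Ioi 0)).prod μ) := by
    intro n
    rw [← integral_exp_mul_reachWeight_of_pos hP hX (hpos n)
      (fun i => by have := hlam i; simp only [Pi.zero_apply] at this; simp only [hlamn]; linarith)
      hθ, integral_prod _ (integrable_exp_mul_reachWeight hX.measurable hrc a (hlamn0 n) hθ)]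
    simp only [integral_const_mul]
  have heq' : ∫ r in Set.Ioi (0 : ℝ), Real.exp (-θ * r) * ∫ ω, reachWeight a lam X (r, ω) ∂μ =
      ∫ p : ℝ × Ω, Real.exp (-θ * p.1) * reachWeight a lam X p
        ∂((volume.restrict (Set.Ioi 0)).prod μ) := by
    rw [integral_prod _ (integrable_exp_mul_reachWeight hX.measurable hrc a hlam hθ)]
    simp only [integral_const_mul]
  simp only [heq]
  rw [heq']
  have hb : Integrable (fun p : ℝ × Ω => Real.exp (-θ * p.1) * (1 : ℝ))
      ((volume.restrict (Set.Ioi 0)).prod μ) :=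
    (exp_neg_integrableOn_Ioi 0 hθ).mul_prod (integrable_const 1)
  refine tendsto_integral_of_dominated_convergence _
    (fun n => (integrable_exp_mul_reachWeight hX.measurable hrc a (hlamn0 n) hθ).1) hb ?_ ?_
  · intro n
    refine Eventually.of_forall fun p => ?_
    rw [Real.norm_of_nonneg (mul_nonneg (Real.exp_pos _).le (reachWeight_nonneg a _ p))]
    exact mul_le_mul_of_nonneg_left (reachWeight_le_one hrc a (hlamn0 n) p) (Real.exp_pos _).le
  · refine Eventually.of_forall fun p => Tendsto.const_mul _ ?_
    by_cases h : ∃ n : ℕ, p.1 ≤ localTime (fun t => X t p.2) n a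
    · simp only [reachWeight_of_exists h, expLocalTimeInv]
      refine (Real.continuous_exp.tendsto _).comp (Tendsto.neg ?_)
      exact tendsto_finsetSum _ fun i _ => ((tendsto_pi_nhds.1 hlim) i).mul_const _
    · simp only [reachWeight_of_not_exists h]
      exact tendsto_const_nhds

omit hP in
theorem measurable_integral_reachWeight (lam : ι → ℝ) :
    Measurable fun r => ∫ ω, reachWeight a lam X (r, ω) ∂μ :=
  (measurable_reachWeight hX.measurable hX.rightContinuous a
    lam).stronglyMeasurable.integral_prod_right'.measurable

omit hP in
theorem integrable_reachWeight {lam : ι → ℝ} (hlam : 0 ≤ lam) (r : ℝ) :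
    Integrable (fun ω => reachWeight a lam X (r, ω)) μ := by
  refine Integrable.of_bound (C := 1) ?_ (Eventually.of_forall fun ω => ?_)
  · exact ((measurable_reachWeight hX.measurable hX.rightContinuous a lam).comp
      measurable_prodMk_left).aestronglyMeasurable
  · rw [Real.norm_of_nonneg (reachWeight_nonneg a lam _)]
    exact reachWeight_le_one hX.rightContinuous a hlam _

/-- The weight decreases in `r` along every path, also across the level where it drops to `0`, so
that the almost everywhere identity from the Laplace transforms holds at every `r > 0`. -/
theorem integral_reachWeight_eq {lam : ι → ℝ} (hlam : 0 ≤ lam) {r : ℝ} (hr : 0 < r) :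
    ∫ ω, reachWeight a lam X (r, ω) ∂μ = Real.exp (-lapExponent (laplacian P π) a lam * r) := by
  have hrc := hX.rightContinuous
  have hint := integrable_reachWeight hX hlam
  have hae := ae_eq_exp_of_integral_exp_mul
    (measurable_integral_reachWeight hX lam)
    (fun r => integral_nonneg fun ω => reachWeight_nonneg a lam _)
    (fun r => (integral_mono (hint r) (integrable_const 1)
      fun ω => reachWeight_le_one hrc a hlam _).trans (by simp))
    (hP.lapExponent_nonneg a fun i => hlam i)
    (fun θ hθ => integral_exp_mul_reachWeight hP hX hlam hθ)
  refine eq_of_antitoneOn_of_ae_eq (fun r _ r' _ hrr' => ?_) (by fun_prop) hae hr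
  refine integral_mono (hint r') (hint r) fun ω => ?_
  by_cases h : ∃ n : ℕ, r' ≤ localTime (fun t => X t ω) n a
  · have h' : ∃ n : ℕ, r ≤ localTime (fun t => X t ω) n a := h.imp fun n hn => hrr'.trans hn
    rw [reachWeight_of_exists (p := (r', ω)) h, reachWeight_of_exists (p := (r, ω)) h',
      expLocalTimeInv, expLocalTimeInv, Real.exp_le_exp, neg_le_neg_iff]
    refine Finset.sum_le_sum fun i _ => mul_le_mul_of_nonneg_left ?_ (hlam i)
    exact monotone_localTime (hrc ω) i (invLocalTime_mono (hrc ω) hrr' h)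
  · rw [reachWeight_of_not_exists (p := (r', ω)) h]
    exact reachWeight_nonneg a lam _

/-- The total local time at `a` is almost surely infinite: for `lam = 0` the weight is the indicator
that it reaches `r`, and its expectation is `1` as `lapExponent` vanishes at `0`. -/
theorem ae_exists_le_localTime (r : ℝ) :
    ∀ᵐ ω ∂μ, ∃ n : ℕ, r ≤ localTime (fun t => X t ω) n a := by
  have hrc := hX.rightContinuous
  wlog hr : 0 < r generalizing r
  · filter_upwards [this 1 one_pos] with ω hω
    exact hω.imp fun n hn => by linarith
  have h1 := integral_reachWeight_eq hP hX (lam := 0) le_rfl hr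
  rw [hP.lapExponent_zero, neg_zero, zero_mul, Real.exp_zero] at h1
  have hint := integrable_reachWeight hX (lam := 0) le_rfl r
  have h2 : ∫ ω, (1 - reachWeight a 0 X (r, ω)) ∂μ = 0 := by
    rw [integral_sub (integrable_const 1) hint, h1]; simp
  rw [integral_eq_zero_iff_of_nonneg
    (fun ω => sub_nonneg.2 (reachWeight_le_one hrc a le_rfl _))
    ((integrable_const 1).sub hint)] at h2
  filter_upwards [h2] with ω hω
  by_contra hcon
  have h3 : reachWeight a 0 X (r, ω) = 0 := reachWeight_of_not_exists (p := (r, ω)) hcon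
  rw [h3] at hω
  simp at hω

/-- The local times at the inverse local time at `a` form a process with Laplace exponent
`lapExponent`. -/
theorem integral_exp_neg_localTime_invLocalTime {lam : ι → ℝ} (hlam : 0 ≤ lam) {r : ℝ}
    (hr : 0 ≤ r) :
    ∫ ω, Real.exp (-∑ i, lam i *
        localTime (fun t => X t ω) (invLocalTime (fun t => X t ω) a r) i) ∂μ =
      Real.exp (-lapExponent (laplacian P π) a lam * r) := by
  rcases hr.eq_or_lt with rfl | hr
  · simp [invLocalTime_zero, localTime_zero]
  rw [← integral_reachWeight_eq hP hX hlam hr]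
  refine integral_congr_ae ?_
  filter_upwards [ae_exists_le_localTime hP hX r] with ω hω
  rw [reachWeight_of_exists (p := (r, ω)) hω, expLocalTimeInv]

end InverseLocalTime

/-! ### The permanental vector and its conditioning at zero -/

section Permanental

variable {ι Ω : Type*} [Fintype ι] [DecidableEq ι] [MeasurableSpace Ω] {μ : Measure Ω}
  [IsProbabilityMeasure μ] {P : Matrix ι ι ℝ} {π : ι → ℝ} {a : ι} {h : ℝ} {ℓ : Ω → ι → ℝ}

variable (hP : IsIrreducibleChain P π) (hh : 0 < h)
  (hℓ : IsPermanental μ 1 (Matrix.single a a h - laplacian P π)⁻¹ ℓ)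

include hP hh hℓ

omit [IsProbabilityMeasure μ] in
theorem integral_exp_neg_permanental {lam : ι → ℝ} (hlam : 0 ≤ lam) :
    ∫ ω, Real.exp (-∑ i, lam i * ℓ ω i) ∂μ =
      minorRatio (laplacian P π) a lam * (h / (h + lapExponent (laplacian P π) a lam)) := by
  rw [hℓ.laplace lam fun i => hlam i, hP.laplace_permanental a hh fun i => hlam i]

omit [IsProbabilityMeasure μ] in
theorem integral_exp_neg_mul_sub_permanental {lam : ι → ℝ} (hlam : 0 ≤ lam) {s : ℝ} (hs : 0 ≤ s) :
    ∫ ω, Real.exp (-(s * ℓ ω a) - ∑ i, lam i * ℓ ω i) ∂μ =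
      minorRatio (laplacian P π) a lam * (h / (h + s + lapExponent (laplacian P π) a lam)) := by
  have hlam' : 0 ≤ lam + Pi.single a s :=
    add_nonneg hlam (Pi.single_nonneg.2 hs)
  have h1 := integral_exp_neg_permanental hP hh hℓ hlam'
  rw [minorRatio_add_single, hP.lapExponent_add_single a fun i => hlam i] at h1
  rw [show h + s + lapExponent (laplacian P π) a lam =
    h + (lapExponent (laplacian P π) a lam + s) by ring, ← h1]
  congr 1
  funext ω
  congr 1
  simp only [Pi.add_apply, add_mul, Finset.sum_add_distrib]
  simp [Pi.single_apply]
  ring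

omit [IsProbabilityMeasure μ] in
theorem integral_exp_neg_mul_permanental {s : ℝ} (hs : 0 ≤ s) :
    ∫ ω, Real.exp (-(s * ℓ ω a)) ∂μ = h / (h + s) := by
  have h1 := integral_exp_neg_mul_sub_permanental hP hh hℓ (lam := 0) le_rfl hs
  simpa [hP.minorRatio_zero, hP.lapExponent_zero] using h1

/-- The value at `a` of the permanental vector is exponential with parameter `h`. -/
theorem map_permanental_apply : μ.map (fun ω => ℓ ω a) =
    (volume.restrict (Set.Ioi (0 : ℝ))).withDensity
      fun y => ENNReal.ofReal (h * Real.exp (-h * y)) := by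
  have hm : Measurable fun ω => ℓ ω a := (measurable_pi_iff.1 hℓ.measurable) a
  have hd : Measurable fun y : ℝ => h * Real.exp (-h * y) := by fun_prop
  have hd0 : ∀ y, 0 ≤ h * Real.exp (-h * y) := fun y => by positivity
  have hfin : ∫⁻ y, ENNReal.ofReal (h * Real.exp (-h * y)) ∂(volume.restrict (Set.Ioi (0 : ℝ)))
      ≠ ⊤ := (hasFiniteIntegral_iff_ofReal (Eventually.of_forall hd0)).1
    ((exp_neg_integrableOn_Ioi 0 hh).const_mul h).2 |>.ne
  have := isFiniteMeasure_withDensity hfin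
  have := Measure.isProbabilityMeasure_map (μ := μ) hm.aemeasurable
  refine ext_of_forall_integral_exp_neg (κ := Unit) (φ := fun _ (r : ℝ) => r)
    (fun _ => continuous_id) (C := Set.Ici 0) isClosed_Ici (fun _ r hr => hr)
    (fun r _ s _ hrs => hrs ()) _ _ ?_ ?_ fun n => ?_
  · exact (ae_map_iff hm.aemeasurable measurableSet_Ici).2
      (Eventually.of_forall fun ω => hℓ.nonneg ω a)
  · exact (withDensity_absolutelyContinuous _ _).ae_le
      ((ae_restrict_mem measurableSet_Ioi).mono fun r hr => le_of_lt (Set.mem_Ioi.1 hr))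
  · have hn : (0 : ℝ) ≤ n () := Nat.cast_nonneg _
    rw [integral_map hm.aemeasurable (by fun_prop),
      integral_withDensity_eq_integral_toReal_smul hd.ennreal_ofReal
        (Eventually.of_forall fun _ => ENNReal.ofReal_lt_top)]
    simp only [ENNReal.toReal_ofReal (hd0 _), smul_eq_mul, Finset.univ_unique,
      Finset.sum_singleton]
    have e1 := integral_exp_neg_mul_permanental hP hh hℓ hn
    have e2 : ∫ y in Set.Ioi (0 : ℝ), Real.exp (-(h + n ()) * y) = (h + n ())⁻¹ := by
      rw [integral_exp_mul_Ioi (by linarith) 0, mul_zero, Real.exp_zero, neg_div_neg_eq, one_div]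
    refine e1.trans ?_
    rw [div_eq_mul_inv, ← e2, ← integral_const_mul]
    congr 1
    funext y
    rw [mul_assoc, ← Real.exp_add]
    congr 2
    change _ = -h * y + -((n () : ℝ) * y)
    ring

theorem volume_absolutelyContinuous_map_permanental :
    volume.restrict (Set.Ioi (0 : ℝ)) ≪ μ.map (fun ω => ℓ ω a) := by
  rw [map_permanental_apply hP hh hℓ]
  refine withDensity_absolutelyContinuous' (by fun_prop) (Eventually.of_forall fun y => ?_)
  exact (ENNReal.ofReal_pos.2 (by positivity)).ne'

/-- The law of the permanental vector conditioned to vanish at `a`, as the limit for `n → ∞` of its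
laws under the measures with density proportional to `exp (-n ℓ_a)`. -/
theorem exists_law_vanishing : ∃ ρ : ProbabilityMeasure (ι → ℝ),
    (∀ᵐ x ∂(ρ : Measure (ι → ℝ)), 0 ≤ x) ∧
      ∀ lam : ι → ℝ, 0 ≤ lam → laplaceTransform ρ lam = minorRatio (laplacian P π) a lam := by
  have hmeas := hℓ.measurable
  have hma : Measurable fun ω => ℓ ω a := (measurable_pi_iff.1 hmeas) a
  have hint : ∀ n : ℕ, Integrable (fun ω => Real.exp (-((n : ℝ) * ℓ ω a))) μ := fun n => by
    refine Integrable.of_bound (C := 1) ?_ (Eventually.of_forall fun ω => ?_)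
    · exact (Real.measurable_exp.comp (hma.const_mul _).neg).aestronglyMeasurable
    · rw [Real.norm_eq_abs, Real.abs_exp, Real.exp_le_one_iff, neg_nonpos]
      exact mul_nonneg (Nat.cast_nonneg _) (hℓ.nonneg ω a)
  have hprob : ∀ n : ℕ, IsProbabilityMeasure (μ.tilted fun ω => -((n : ℝ) * ℓ ω a)) := fun n =>
    isProbabilityMeasure_tilted (hint n)
  let ρ : ℕ → ProbabilityMeasure (ι → ℝ) := fun n =>
    ⟨(μ.tilted fun ω => -((n : ℝ) * ℓ ω a)).map ℓ,
      Measure.isProbabilityMeasure_map hmeas.aemeasurable⟩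
  have hρ0 : ∀ n, ∀ᵐ x ∂(ρ n : Measure (ι → ℝ)), 0 ≤ x := fun n =>
    (ae_map_iff hmeas.aemeasurable measurableSet_Ici).2
      (Eventually.of_forall fun ω => hℓ.nonneg ω)
  have hlap : ∀ n (lam : ι → ℝ), 0 ≤ lam → laplaceTransform (ρ n) lam =
      minorRatio (laplacian P π) a lam *
        ((h + n) / (h + n + lapExponent (laplacian P π) a lam)) := by
    intro n lam hlam
    have e1 : laplaceTransform (ρ n) lam =
        ∫ ω, Real.exp (-∑ i, lam i * ℓ ω i) ∂(μ.tilted fun ω => -((n : ℝ) * ℓ ω a)) :=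
      integral_map hmeas.aemeasurable (Continuous.aestronglyMeasurable (by fun_prop))
    have hn : (0 : ℝ) ≤ n := Nat.cast_nonneg n
    have hψ := hP.lapExponent_nonneg a fun i => hlam i
    rw [e1, integral_tilted, integral_exp_neg_mul_permanental hP hh hℓ hn]
    have e2 : ∀ ω, (Real.exp (-((n : ℝ) * ℓ ω a)) / (h / (h + n))) •
        Real.exp (-∑ i, lam i * ℓ ω i) =
        ((h + n) / h) * Real.exp (-((n : ℝ) * ℓ ω a) - ∑ i, lam i * ℓ ω i) := by
      intro ω
      rw [sub_eq_add_neg, Real.exp_add, smul_eq_mul]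
      field_simp
    simp only [e2]
    rw [integral_const_mul, integral_exp_neg_mul_sub_permanental hP hh hℓ hlam hn]
    have : 0 < h + n + lapExponent (laplacian P π) a lam := by positivity
    field_simp
  have hconst : ∀ {ε : ℝ}, 0 < ε → (0 : ι → ℝ) ≤ fun _ => ε := fun hε _ => hε.le
  have hcont : Tendsto (fun ε : ℝ => (fun _ => ε : ι → ℝ)) (𝓝[>] 0) (𝓝 0) := by
    have : Continuous fun ε : ℝ => (fun _ => ε : ι → ℝ) := by fun_prop
    exact (this.tendsto 0).mono_left nhdsWithin_le_nhds
  -- `(h + n) / (h + n + ψ)` increases in `n`, so the case `n = 0` bounds all transforms below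
  have htight : IsTightMeasureSet {(ρ n : Measure (ι → ℝ)) | n} := by
    refine isTightMeasureSet_of_laplaceTransform (g := fun ε =>
      minorRatio (laplacian P π) a (fun _ => ε) *
        (h / (h + lapExponent (laplacian P π) a (fun _ => ε)))) ?_ ?_ ?_ ?_
    · rintro _ ⟨n, rfl⟩; infer_instance
    · rintro _ ⟨n, rfl⟩; exact hρ0 n
    · have h1 := (hP.continuousAt_minorRatio a (lam := 0) fun _ => le_rfl).tendsto.comp hcont
      have h2 := (hP.continuousAt_lapExponent a (lam := 0) fun _ => le_rfl).tendsto.comp hcont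
      rw [hP.minorRatio_zero] at h1
      rw [hP.lapExponent_zero] at h2
      have h3 := h1.mul ((tendsto_const_nhds (x := h)).div (h2.const_add h) (by simpa using hh.ne'))
      rw [add_zero, div_self hh.ne', one_mul] at h3
      exact h3
    · rintro _ ⟨n, rfl⟩ ε hε
      rw [hlap n _ (hconst hε)]
      refine mul_le_mul_of_nonneg_left ?_ (hP.minorRatio_pos a fun _ => hε.le).le
      have hψ := hP.lapExponent_nonneg a (lam := fun _ => ε) fun _ => hε.le
      have hn : (0 : ℝ) ≤ n := Nat.cast_nonneg n
      rw [div_le_div_iff₀ (by positivity) (by positivity)]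
      nlinarith [mul_nonneg hn hψ]
  obtain ⟨ρ', h0, h1, -⟩ := exists_tendsto_of_laplaceTransform (l := atTop) hρ0 htight
    (L := minorRatio (laplacian P π) a) fun lam hlam => by
      simp only [hlap _ lam hlam]
      have hψ := hP.lapExponent_nonneg a fun i => hlam i
      have h4 : Tendsto (fun n : ℕ => h + (n : ℝ)) atTop atTop :=
        tendsto_atTop_add_const_left _ _ tendsto_natCast_atTop_atTop
      have h5 : Tendsto (fun n : ℕ => (h + (n : ℝ)) /
          (h + n + lapExponent (laplacian P π) a lam)) atTop (𝓝 1) := by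
        have h6 : Tendsto (fun n : ℕ => 1 - lapExponent (laplacian P π) a lam /
            (h + n + lapExponent (laplacian P π) a lam)) atTop (𝓝 (1 - 0)) :=
          tendsto_const_nhds.sub (tendsto_const_nhds.div_atTop
            (tendsto_atTop_add_const_right _ _ h4))
        rw [sub_zero] at h6
        refine h6.congr fun n => ?_
        have : 0 < h + n + lapExponent (laplacian P π) a lam := by positivity
        field_simp
        ring
      simpa using h5.const_mul (minorRatio (laplacian P π) a lam)
  exact ⟨ρ', h0, h1⟩

end Permanental

/-! ### Continuous conditional laws -/

section CondLaw

variable {ι Ω : Type*} [Fintype ι] [DecidableEq ι] [MeasurableSpace Ω] {μ : Measure Ω}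
  [IsProbabilityMeasure μ] {P : Matrix ι ι ℝ} {π : ι → ℝ} {a : ι} {h : ℝ} {ℓ : Ω → ι → ℝ}

/-- A Markov kernel `κ` whose value at `y ≥ 0` is the law on the orthant with Laplace transform
`minorRatio * exp (-y * lapExponent)`. -/
structure IsLaplaceKernel (Q : Matrix ι ι ℝ) (a : ι) (κ : Kernel ℝ (ι → ℝ)) : Prop where
  markov : IsMarkovKernel κ
  nonneg : ∀ y, ∀ᵐ x ∂(κ y), 0 ≤ x
  laplace : ∀ y, 0 ≤ y → ∀ lam : ι → ℝ, 0 ≤ lam →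
    laplaceTransform (κ y) lam = minorRatio Q a lam * Real.exp (-lapExponent Q a lam * y)

/-- Weak continuity follows from the continuity theorem, as the Laplace transforms are continuous
in `y`. -/
theorem IsLaplaceKernel.continuousOn (hP : IsIrreducibleChain P π) {κ : Kernel ℝ (ι → ℝ)}
    (hκ : IsLaplaceKernel (laplacian P π) a κ) (f : (ι → ℝ) →ᵇ ℝ) :
    ContinuousOn (fun y => ∫ w, f w ∂(κ y)) (Set.Ici 0) := by
  have := hκ.markov
  intro y₀ hy₀
  have hy₀ : 0 ≤ y₀ := hy₀
  -- clamping `y` to `[0, y₀ + 1]` gives a tight family without changing it near `y₀`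
  set cl : ℝ → ℝ := fun y => min (max y 0) (y₀ + 1) with hcl
  have hcl0 : ∀ y, 0 ≤ cl y := fun y => le_min (le_max_right _ _) (by linarith)
  have hcl1 : ∀ y, cl y ≤ y₀ + 1 := fun y => min_le_right _ _
  have hcly : ∀ y, 0 ≤ y → y ≤ y₀ + 1 → cl y = y := fun y h1 h2 => by
    simp only [hcl, max_eq_left h1, min_eq_left h2]
  let ρ : ℝ → ProbabilityMeasure (ι → ℝ) := fun y => ⟨κ (cl y), inferInstance⟩
  have hcont : Tendsto (fun ε : ℝ => (fun _ => ε : ι → ℝ)) (𝓝[>] 0) (𝓝 0) := by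
    have : Continuous fun ε : ℝ => (fun _ => ε : ι → ℝ) := by fun_prop
    exact (this.tendsto 0).mono_left nhdsWithin_le_nhds
  have htight : IsTightMeasureSet {(ρ y : Measure (ι → ℝ)) | y} := by
    refine isTightMeasureSet_of_laplaceTransform (g := fun ε =>
      minorRatio (laplacian P π) a (fun _ => ε) *
        Real.exp (-lapExponent (laplacian P π) a (fun _ => ε) * (y₀ + 1))) ?_ ?_ ?_ ?_
    · rintro _ ⟨y, rfl⟩; infer_instance
    · rintro _ ⟨y, rfl⟩; exact hκ.nonneg _
    · have h1 := (hP.continuousAt_minorRatio a (lam := 0) fun _ => le_rfl).tendsto.comp hcont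
      have h2 := (hP.continuousAt_lapExponent a (lam := 0) fun _ => le_rfl).tendsto.comp hcont
      rw [hP.minorRatio_zero] at h1
      rw [hP.lapExponent_zero] at h2
      have h3 := h1.mul ((Real.continuous_exp.tendsto _).comp ((h2.neg).mul_const (y₀ + 1)))
      simpa using h3
    · rintro _ ⟨y, rfl⟩ ε hε
      change _ ≤ laplaceTransform (κ (cl y)) _
      rw [hκ.laplace _ (hcl0 y) _ fun _ => hε.le]
      refine mul_le_mul_of_nonneg_left (Real.exp_le_exp.2 ?_)
        (hP.minorRatio_pos a fun _ => hε.le).le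
      nlinarith [hP.lapExponent_nonneg a (lam := fun _ => ε) fun _ => hε.le, hcl1 y]
  have hne : (𝓝[Set.Ici 0] y₀).NeBot := nhdsWithin_Ici_neBot hy₀
  obtain ⟨ρ', h0, h1, h2⟩ := exists_tendsto_of_laplaceTransform (l := 𝓝[Set.Ici 0] y₀)
    (ρ := ρ) (fun y => hκ.nonneg _) htight
    (L := fun lam => minorRatio (laplacian P π) a lam *
      Real.exp (-lapExponent (laplacian P π) a lam * y₀)) fun lam hlam => by
      change Tendsto (fun y => laplaceTransform (κ (cl y)) lam) _ _
      simp only [hκ.laplace _ (hcl0 _) _ hlam]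
      have hcc : Continuous fun y => minorRatio (laplacian P π) a lam *
          Real.exp (-lapExponent (laplacian P π) a lam * cl y) := by fun_prop
      have h3 := hcc.tendsto y₀
      rw [hcly y₀ hy₀ (by linarith)] at h3
      exact h3.mono_left nhdsWithin_le_nhds
  have heq : (ρ' : Measure (ι → ℝ)) = κ y₀ := ext_of_laplaceTransform h0 (hκ.nonneg _)
    fun lam hlam => by rw [h1 lam hlam, hκ.laplace y₀ hy₀ lam hlam]
  have h3 := (ProbabilityMeasure.tendsto_iff_forall_integral_tendsto.1 h2) f
  rw [heq] at h3
  refine h3.congr' ?_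
  have hev : ∀ᶠ y in 𝓝[Set.Ici 0] y₀, y ≤ y₀ + 1 :=
    nhdsWithin_le_nhds (Iic_mem_nhds (by linarith))
  filter_upwards [hev, self_mem_nhdsWithin] with y hy1 hy0
  change ∫ w, f w ∂(κ (cl y)) = _
  rw [hcly y hy0 hy1]

omit [DecidableEq ι] in
/-- A conditional law is identified by joint Laplace transforms. -/
theorem hasCondDistrib_of_laplaceTransform {W : Ω → ι → ℝ} {Y : Ω → ℝ} (hW : Measurable W)
    (hY : Measurable Y) (hW0 : ∀ ω, 0 ≤ W ω) (hY0 : ∀ ω, 0 ≤ Y ω) {κ : Kernel ℝ (ι → ℝ)}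
    [IsMarkovKernel κ] (hκ : ∀ y, ∀ᵐ x ∂(κ y), 0 ≤ x)
    (hlap : ∀ (s : ℝ) (lam : ι → ℝ), 0 ≤ s → 0 ≤ lam →
      ∫ ω, Real.exp (-(s * Y ω) - ∑ i, lam i * W ω i) ∂μ =
        ∫ ω, Real.exp (-(s * Y ω)) * laplaceTransform (κ (Y ω)) lam ∂μ) :
    HasCondDistrib W Y κ μ := by
  have hYW : Measurable fun ω => (Y ω, W ω) := hY.prodMk hW
  refine ⟨hYW.aemeasurable, ?_⟩
  have := Measure.isProbabilityMeasure_map (μ := μ) hY.aemeasurable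
  have := Measure.isProbabilityMeasure_map (μ := μ) hYW.aemeasurable
  set C : Set (ℝ × (ι → ℝ)) := Set.Ici 0 ×ˢ Set.Ici 0 with hC
  have hCc : IsClosed C := isClosed_Ici.prod isClosed_Ici
  have hsupp : ∀ᵐ p ∂((μ.map Y) ⊗ₘ κ), p ∈ C := by
    refine Measure.ae_compProd_of_ae_ae hCc.measurableSet ?_
    have h1 : ∀ᵐ y ∂(μ.map Y), y ∈ Set.Ici (0 : ℝ) :=
      (ae_map_iff hY.aemeasurable measurableSet_Ici).2 (Eventually.of_forall hY0)
    filter_upwards [h1] with y hy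
    filter_upwards [hκ y] with x hx
    exact ⟨hy, hx⟩
  -- the coordinates of `ℝ × ℝ^ι` are indexed by `Option ι`
  refine ext_of_forall_integral_exp_neg (κ := Option ι)
    (φ := fun k (p : ℝ × (ι → ℝ)) => k.elim p.1 p.2) ?_ hCc ?_ ?_ _ _ ?_ hsupp ?_
  · rintro (_ | i)
    · exact continuous_fst
    · exact (continuous_apply i).comp continuous_snd
  · rintro (_ | i) p hp
    · exact hp.1
    · exact hp.2 i
  · rintro p - q - hpq
    exact Prod.ext (hpq none) (funext fun i => hpq (some i))
  · exact (ae_map_iff hYW.aemeasurable hCc.measurableSet).2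
      (Eventually.of_forall fun ω => ⟨hY0 ω, hW0 ω⟩)
  · intro n
    have hexp : ∀ p : ℝ × (ι → ℝ), -∑ k, (n k : ℝ) * k.elim p.1 p.2 =
        -((n none : ℝ) * p.1) - ∑ i, (n (some i) : ℝ) * p.2 i := by
      intro p
      rw [Fintype.sum_option]
      simp only [Option.elim]
      ring
    simp only [hexp]
    have hc : Continuous fun p : ℝ × (ι → ℝ) =>
        Real.exp (-((n none : ℝ) * p.1) - ∑ i, (n (some i) : ℝ) * p.2 i) := by fun_prop
    have hn : ∀ k, (0 : ℝ) ≤ n k := fun k => Nat.cast_nonneg _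
    rw [integral_map hYW.aemeasurable hc.aestronglyMeasurable, hlap _ _ (hn none) fun i => hn _,
      Measure.integral_compProd]
    · simp only [sub_eq_add_neg, Real.exp_add, integral_const_mul]
      rw [integral_map hY.aemeasurable]
      · rfl
      · refine AEStronglyMeasurable.mul (Continuous.aestronglyMeasurable (by fun_prop)) ?_
        have hm : StronglyMeasurable fun p : ℝ × (ι → ℝ) =>
            Real.exp (-∑ i, (n (some i) : ℝ) * p.2 i) :=
          Continuous.stronglyMeasurable (by fun_prop)
        exact hm.integral_kernel_prod_right'.aestronglyMeasurable
    · refine Integrable.of_bound (C := 1) hc.aestronglyMeasurable ?_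
      filter_upwards [hsupp] with p hp
      rw [Real.norm_eq_abs, Real.abs_exp, Real.exp_le_one_iff]
      have h1 := mul_nonneg (hn none) hp.1
      have h2 : 0 ≤ ∑ i, (n (some i) : ℝ) * p.2 i :=
        Finset.sum_nonneg fun i _ => mul_nonneg (hn _) (hp.2 i)
      linarith

omit [DecidableEq ι] in
/-- Two continuous conditional laws agree at every `y ≥ 0` as soon as Lebesgue measure on `(0, ∞)`
is absolutely continuous with respect to the law of the conditioning variable. -/
theorem IsContCondLaw.eq {W : Ω → ι → ℝ} {Y : Ω → ℝ} (hY : Measurable Y)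
    (hac : volume.restrict (Set.Ioi (0 : ℝ)) ≪ μ.map Y) {κ η : Kernel ℝ (ι → ℝ)}
    (hκ : IsContCondLaw μ W Y κ) (hη : IsContCondLaw μ W Y η) {y : ℝ} (hy : 0 ≤ y) :
    κ y = η y := by
  have := hκ.markov
  have := hη.markov
  have := Measure.isProbabilityMeasure_map (μ := μ) hY.aemeasurable
  have h1 : (μ.map Y) ⊗ₘ κ = (μ.map Y) ⊗ₘ η :=
    hκ.hasCondDistrib.map_eq.symm.trans hη.hasCondDistrib.map_eq
  have h2 := hac.ae_le (Kernel.ae_eq_of_compProd_eq h1)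
  refine ext_of_forall_integral_eq_of_IsFiniteMeasure fun f => ?_
  have h3 : Set.EqOn (fun y => ∫ w, f w ∂(κ y)) (fun y => ∫ w, f w ∂(η y)) (Set.Ioi 0) := by
    refine Measure.eqOn_open_of_ae_eq (μ := volume) ?_ isOpen_Ioi
      ((hκ.continuousOn f).mono Set.Ioi_subset_Ici_self)
      ((hη.continuousOn f).mono Set.Ioi_subset_Ici_self)
    filter_upwards [h2] with y hy
    rw [hy]
  exact h3.of_subset_closure (hκ.continuousOn f) (hη.continuousOn f) Set.Ioi_subset_Ici_self
    (by rw [closure_Ioi]) hy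

variable (hP : IsIrreducibleChain P π) (hh : 0 < h)
  (hℓ : IsPermanental μ 1 (Matrix.single a a h - laplacian P π)⁻¹ ℓ)

include hP hh hℓ

/-- The conditional law given `ℓ_a = y` of a vector with the joint transform of `ℓ` plus independent
local times at the inverse local time `r`. Multiplying by `exp (-r ψ)` shifts `y` to `y + r`. -/
theorem IsLaplaceKernel.isContCondLaw {κ : Kernel ℝ (ι → ℝ)}
    (hκ : IsLaplaceKernel (laplacian P π) a κ) {r : ℝ} (hr : 0 ≤ r) {W : Ω → ι → ℝ}
    (hW : Measurable W) (hW0 : ∀ ω, 0 ≤ W ω)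
    (hlap : ∀ (s : ℝ) (lam : ι → ℝ), 0 ≤ s → 0 ≤ lam →
      ∫ ω, Real.exp (-(s * ℓ ω a) - ∑ i, lam i * W ω i) ∂μ =
        minorRatio (laplacian P π) a lam * (h / (h + s + lapExponent (laplacian P π) a lam)) *
          Real.exp (-lapExponent (laplacian P π) a lam * r)) :
    IsContCondLaw μ W (fun ω => ℓ ω a) (κ.comap (fun y => y + r) (measurable_add_const r)) := by
  have := hκ.markov
  have hm : Measurable fun ω => ℓ ω a := (measurable_pi_iff.1 hℓ.measurable) a
  refine ⟨inferInstance, ?_, fun f => ?_⟩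
  · refine hasCondDistrib_of_laplaceTransform hW hm hW0 (fun ω => hℓ.nonneg ω a)
      (fun y => hκ.nonneg _) fun s lam hs hlam => ?_
    rw [hlap s lam hs hlam]
    have hψ := hP.lapExponent_nonneg a fun i => hlam i
    have e1 : ∀ ω, Real.exp (-(s * ℓ ω a)) * laplaceTransform
        (κ.comap (fun y => y + r) (measurable_add_const r) (ℓ ω a)) lam =
        minorRatio (laplacian P π) a lam * Real.exp (-lapExponent (laplacian P π) a lam * r) *
          Real.exp (-((s + lapExponent (laplacian P π) a lam) * ℓ ω a)) := by
      intro ω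
      rw [Kernel.comap_apply, hκ.laplace _ (add_nonneg (hℓ.nonneg ω a) hr) lam hlam,
        mul_left_comm, mul_assoc, ← Real.exp_add, ← Real.exp_add]
      congr 2
      ring
    simp only [e1]
    rw [integral_const_mul, integral_exp_neg_mul_permanental hP hh hℓ (add_nonneg hs hψ)]
    ring
  · have h1 := hκ.continuousOn hP f
    exact h1.comp (continuous_add_const r).continuousOn fun y hy => add_nonneg hy hr

end CondLaw

/-! ### The isomorphism -/

section RayKnightIsomorphism

variable {ι Ω : Type*} [Fintype ι] [DecidableEq ι] [MeasurableSpace ι] [DiscreteMeasurableSpace ι]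
  [MeasurableSpace Ω] {μ : Measure Ω} [IsProbabilityMeasure μ] {P : Matrix ι ι ℝ} {π : ι → ℝ}
  {a : ι} {h : ℝ} {ℓ : Ω → ι → ℝ} {X : ℝ≥0 → Ω → ι}

/-- The local times of the process `X` at the inverse local time `r` at `a`. -/
def inverseField (X : ℝ≥0 → Ω → ι) (a : ι) (r : ℝ) (ω : Ω) : ι → ℝ :=
  localTime (fun t => X t ω) (invLocalTime (fun t => X t ω) a r)

theorem measurable_uncurry_inverseField {Ω : Type*} [MeasurableSpace Ω] {X : ℝ≥0 → Ω → ι}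
    (hX : ∀ t, Measurable (X t)) (hrc : ∀ ω t, ∀ᶠ s in 𝓝[≥] t, X s ω = X t ω) (a : ι) :
    Measurable (fun p : ℝ × Ω => inverseField X a p.1 p.2) :=
  measurable_localTime_invLocalTime hX hrc a

theorem measurable_inverseField {Ω : Type*} [MeasurableSpace Ω] {X : ℝ≥0 → Ω → ι}
    (hX : ∀ t, Measurable (X t)) (hrc : ∀ ω t, ∀ᶠ s in 𝓝[≥] t, X s ω = X t ω) (a : ι) (r : ℝ) :
    Measurable (inverseField X a r) := by
  have heq : inverseField X a r =
      (fun p : ℝ × Ω => inverseField X a p.1 p.2) ∘ fun ω => (r, ω) := rfl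
  rw [heq]
  exact Measurable.comp (measurable_uncurry_inverseField hX hrc a) measurable_prodMk_left

omit [IsProbabilityMeasure μ] in
theorem inverseField_nonneg (hX : IsMarkovChain μ (laplacian P π) a X) (r : ℝ) (ω : Ω) :
    0 ≤ inverseField X a r ω := fun i => localTime_nonneg (hX.rightContinuous ω) _ i

omit [IsProbabilityMeasure μ] in
/-- The local times at an inverse local time are a function of the path of the chain, hence
independent of whatever is independent of that path. -/
theorem indepFun_inverseField {Q : Matrix ι ι ℝ} (hX : IsMarkovChain μ Q a X)
    (hind : IndepFun ℓ (fun ω t => X t ω) μ) (r : ℝ) : IndepFun ℓ (inverseField X a r) μ := by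
  rw [IndepFun_iff_Indep] at hind ⊢
  refine indep_of_indep_of_le_right hind ?_
  have h1 : ∀ t, Measurable[MeasurableSpace.comap (fun ω t => X t ω) MeasurableSpace.pi] (X t) :=
    fun t => (measurable_pi_apply t).comp (comap_measurable fun ω t => X t ω)
  have h3 : Measurable[MeasurableSpace.comap (fun ω t => X t ω) MeasurableSpace.pi]
      (inverseField X a r) :=
    @measurable_inverseField ι _ _ _ _ Ω
      (MeasurableSpace.comap (fun ω t => X t ω) MeasurableSpace.pi) X h1 hX.rightContinuous a r
  exact h3.comap_le

/-- The kernel is realized by adding, to a vector distributed as the permanental vector conditioned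
to vanish at `a`, the independent local times at the inverse local time `y`. -/
theorem exists_isLaplaceKernel (hP : IsIrreducibleChain P π) (hh : 0 < h)
    (hℓ : IsPermanental μ 1 (Matrix.single a a h - laplacian P π)⁻¹ ℓ)
    (hX : IsMarkovChain μ (laplacian P π) a X) :
    ∃ κ : Kernel ℝ (ι → ℝ), IsLaplaceKernel (laplacian P π) a κ := by
  obtain ⟨ρ, hρ0, hρ⟩ := exists_law_vanishing hP hh hℓ
  -- `max y 0` keeps the values at `y < 0` on the orthant; the transform is prescribed for `y ≥ 0`
  set F : ℝ × ((ι → ℝ) × Ω) → ι → ℝ := fun q => q.2.1 + inverseField X a (max q.1 0) q.2.2 with hF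
  have hFm : Measurable F := by
    have h1 : Measurable fun q : ℝ × ((ι → ℝ) × Ω) => (max q.1 0, q.2.2) :=
      (measurable_fst.max measurable_const).prodMk (measurable_snd.comp measurable_snd)
    have h2 := Measurable.comp
      (measurable_uncurry_inverseField hX.measurable hX.rightContinuous a) h1
    exact (measurable_fst.comp measurable_snd).add h2
  let κ : Kernel ℝ (ι → ℝ) :=
    (Kernel.id ×ₖ Kernel.const ℝ ((ρ : Measure (ι → ℝ)).prod μ)).map F
  have hκ : ∀ y, κ y = ((ρ : Measure (ι → ℝ)).prod μ).map fun p => F (y, p) := by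
    intro y
    rw [Kernel.map_apply _ hFm, Kernel.prod_apply, Kernel.id_apply, Kernel.const_apply,
      Measure.dirac_prod, Measure.map_map hFm measurable_prodMk_left]
    rfl
  have hFy : ∀ y, Measurable fun p => F (y, p) := fun y => hFm.comp measurable_prodMk_left
  refine ⟨κ, Kernel.IsMarkovKernel.map _ hFm, fun y => ?_, fun y hy lam hlam => ?_⟩
  · rw [hκ, ae_map_iff (hFy y).aemeasurable measurableSet_Ici]
    have h1 : ∀ᵐ p ∂((ρ : Measure (ι → ℝ)).prod μ), 0 ≤ p.1 :=
      Measure.quasiMeasurePreserving_fst.ae hρ0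
    filter_upwards [h1] with p hp
    exact add_nonneg hp (inverseField_nonneg hX _ _)
  · rw [laplaceTransform, hκ, integral_map (hFy y).aemeasurable
      (Continuous.aestronglyMeasurable (by fun_prop))]
    simp only [hF, Pi.add_apply, mul_add, Finset.sum_add_distrib, neg_add, Real.exp_add,
      max_eq_left hy]
    rw [integral_prod_mul (fun x : ι → ℝ => Real.exp (-∑ i, lam i * x i))
      (fun ω => Real.exp (-∑ i, lam i * inverseField X a y ω i)), ← hρ lam hlam,
      ← integral_exp_neg_localTime_invLocalTime hP hX hlam hy]
    rfl

/-- The joint transform of `ℓ_a` and `ℓ` plus the local times at the inverse local time `r`. -/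
theorem integral_exp_neg_permanental_add_inverseField (hP : IsIrreducibleChain P π) (hh : 0 < h)
    (hℓ : IsPermanental μ 1 (Matrix.single a a h - laplacian P π)⁻¹ ℓ)
    (hX : IsMarkovChain μ (laplacian P π) a X) (hind : IndepFun ℓ (fun ω t => X t ω) μ)
    {r : ℝ} (hr : 0 ≤ r) {s : ℝ} {lam : ι → ℝ} (hs : 0 ≤ s) (hlam : 0 ≤ lam) :
    ∫ ω, Real.exp (-(s * ℓ ω a) - ∑ i, lam i * (ℓ ω + inverseField X a r ω) i) ∂μ =
      minorRatio (laplacian P π) a lam * (h / (h + s + lapExponent (laplacian P π) a lam)) *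
        Real.exp (-lapExponent (laplacian P π) a lam * r) := by
  have h1 := (indepFun_inverseField hX hind r).integral_fun_comp_mul_comp
    (f := fun x : ι → ℝ => Real.exp (-(s * x a) - ∑ i, lam i * x i))
    (g := fun x : ι → ℝ => Real.exp (-∑ i, lam i * x i))
    hℓ.measurable.aemeasurable
    (measurable_inverseField hX.measurable hX.rightContinuous a r).aemeasurable
    (Continuous.aestronglyMeasurable (by fun_prop))
    (Continuous.aestronglyMeasurable (by fun_prop))
  rw [← integral_exp_neg_localTime_invLocalTime hP hX hlam hr,
    ← integral_exp_neg_mul_sub_permanental hP hh hℓ hlam hs]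
  refine Eq.trans ?_ h1
  congr 1
  funext ω
  rw [← Real.exp_add]
  congr 1
  simp only [Pi.add_apply, mul_add, Finset.sum_add_distrib]
  ring

end RayKnightIsomorphism

end RayKnight

end

theorem theorem3p4 {ι Ω : Type*} [Fintype ι] [DecidableEq ι]
    [MeasurableSpace ι] [DiscreteMeasurableSpace ι] [MeasurableSpace Ω]
    (μ : Measure Ω) [IsProbabilityMeasure μ]
    (P : Matrix ι ι ℝ) (π : ι → ℝ) (hP : RayKnight.IsIrreducibleChain P π)
    (a : ι) (h : ℝ) (hh : 0 < h)
    (ℓ : Ω → ι → ℝ)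
    (hℓ : RayKnight.IsPermanental μ 1
      (Matrix.single a a h - RayKnight.laplacian P π)⁻¹ ℓ)
    (X : ℝ≥0 → Ω → ι) (hX : RayKnight.IsMarkovChain μ (RayKnight.laplacian P π) a X)
    (hind : IndepFun ℓ (fun ω t => X t ω) μ) :
    -- the continuous conditional law of `ℓ` given `ℓ_a` exists
    (∃ κ : Kernel ℝ (ι → ℝ), RayKnight.IsContCondLaw μ ℓ (fun ω => ℓ ω a) κ) ∧
    ∀ r : ℝ, 0 ≤ r →
      -- the continuous conditional law of `ℓ + 𝓛_{τ_inv(r)}` given `ℓ_a` exists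
      (∃ η : Kernel ℝ (ι → ℝ), RayKnight.IsContCondLaw μ
        (fun ω => ℓ ω + RayKnight.localTime (fun t => X t ω)
          (RayKnight.invLocalTime (fun t => X t ω) a r)) (fun ω => ℓ ω a) η) ∧
      -- `E_a[u(ℓ + 𝓛_{τ_inv(r)}) | ℓ_a = 0] = E[u(ℓ) | ℓ_a = r]`
      ∀ κ η : Kernel ℝ (ι → ℝ),
        RayKnight.IsContCondLaw μ ℓ (fun ω => ℓ ω a) κ →
        RayKnight.IsContCondLaw μ
          (fun ω => ℓ ω + RayKnight.localTime (fun t => X t ω)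
            (RayKnight.invLocalTime (fun t => X t ω) a r)) (fun ω => ℓ ω a) η →
        ∀ u : (ι → ℝ) → ℂ, RayKnight.IsTestFunction u →
          ∫ l, u l ∂(η 0) = ∫ l, u l ∂(κ r) := by
  -- `κ₀ y` is the law of `ℓ` given `ℓ_a = y`, and `κ₀ (y + r)` that of `ℓ` plus the local times
  obtain ⟨κ₀, hκ₀⟩ := RayKnight.exists_isLaplaceKernel hP hh hℓ hX
  have hm : Measurable fun ω => ℓ ω a := (measurable_pi_iff.1 hℓ.measurable) a
  have hac := RayKnight.volume_absolutelyContinuous_map_permanental hP hh hℓ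
  have hℓlaw := hκ₀.isContCondLaw hP hh hℓ le_rfl hℓ.measurable (fun ω => hℓ.nonneg ω)
    fun s lam hs hlam => by
      rw [RayKnight.integral_exp_neg_mul_sub_permanental hP hh hℓ hlam hs]; simp
  refine ⟨⟨_, hℓlaw⟩, fun r hr => ?_⟩
  have hWlaw := hκ₀.isContCondLaw hP hh hℓ hr
    (hℓ.measurable.add (RayKnight.measurable_inverseField hX.measurable hX.rightContinuous a r))
    (fun ω => add_nonneg (hℓ.nonneg ω) (RayKnight.inverseField_nonneg hX r ω))
    fun s lam hs hlam =>
      RayKnight.integral_exp_neg_permanental_add_inverseField hP hh hℓ hX hind hr hs hlam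
  refine ⟨⟨_, hWlaw⟩, fun κ η hκ hη u _ => ?_⟩
  rw [hκ.eq hm hac hℓlaw hr, hη.eq hm hac hWlaw le_rfl, ProbabilityTheory.Kernel.comap_apply,
    ProbabilityTheory.Kernel.comap_apply, zero_add, add_zero]
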